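/- **Conventions.** $\sigma^0=1,\sigma^1,\sigma^2,\sigma^3$ are the Pauli matrices, $\partial=\partial_z$. For weights $w_a$ and generators $\mathbf S^a$ the Lax matrix is $\mathrm L=\frac12\sum_{a=0}^3 w_a(u)\,\sigma^a\otimes\mathbf S^a$. The generators $\mathbf S^a=\mathbf S^a_\ell$ of spin $\ell\in\mathbb C$ are expressed in $z,\partial$, and $\mathrm L$ is written as $\mathrm L(u_1,u_2)$ with $u_1=\frac{u}{2\eta}+\ell$, $u_2=\frac{u}{2\eta}-1-\ell$ (with $2\eta=1$ in cases 1 and 2), so that $u_1-u_2=2\ell+1$ and $\mathrm L(u_2,u_1)$ is the Lax matrix of spin $-1-\ell$ with the same $u$. In cases 1 and 2 operators act on finite linear combinations of the formal powers $z^x$, $x\in\mathbb C$: $\partial z^x=xz^{x-1}$, $z^b z^x=z^{x+b}$, and $\Phi(z\partial)z^x=\Phi(x)z^x$. Put $V_\lambda=\mathrm{span}\{z^{\lambda+n}:n\in\mathbb Z\}$. 1. *No deformation.* $w_0(u)=2u$, $w_1=w_2=w_3=1$; $\mathbf S^0=1$, $\mathbf S^1\pm i\mathbf S^2=2S^\pm$,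 $\mathbf S^3=2S$ with $S^-=-\partial$, $S=z\partial-\ell$, $S^+=z^2\partial-2\ell z$. 2. *$q$-deformation.* $q=e^h$ with $\operatorname{Re}h<0$, $q^x:=e^{hx}$, $[x]_q=\frac{q^x-q^{-x}}{q-q^{-1}}$, $(y;q^2)=\prod_{k\ge0}(1-yq^{2k})$; $w_0(u)=\frac{q^u-q^{-u}}{q^{1/2}-q^{-1/2}}$, $w_3(u)=\frac{q^u+q^{-u}}{q^{1/2}+q^{-1/2}}$, $w_1=w_2=1$; $\mathbf S^0=\frac{q^S+q^{-S}}{q^{1/2}+q^{-1/2}}$, $\mathbf S^3=\frac{q^S-q^{-S}}{q^{1/2}-q^{-1/2}}$, $\mathbf S^1\pm i\mathbf S^2=2S^\pm$ with $S^-=-z^{-1}[z\partial]_q$, $S=z\partial-\ell$, $S^+=z[z\partial-2\ell]_q$. 3. *Elliptic deformation.* $\operatorname{Im}\tau>0$, $\operatorname{Im}\eta>0$. With $\theta_{\alpha,\beta}(z|\tau)=\sum_{n\in\mathbb Z}e^{\pi i(n+\alpha)^2\tau+2\pi i(n+\alpha)(z+\beta)}$ let $\theta_1,\theta_2,\theta_3,\theta_4$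 be $\theta_{\alpha,\beta}$ for $(\alpha,\beta)=(\frac12,\frac12),(\frac12,0),(0,0),(0,\frac12)$. Put $[x]=\theta_1(2\eta x|\tau)$, $[x]_k=\prod_{j=0}^{k-1}[x+j]$ (so $[x]_0=1$), $[k]!=[1][2]\cdots[k]$, and $\gamma(z)=\Gamma(\eta z|\tau,2\eta)$, where $\Gamma(z|\tau,\tau')=\prod_{n,m\ge0}\frac{1-e^{2\pi i(\tau(n+1)+\tau'(m+1)-z)}}{1-e^{2\pi i(\tau n+\tau' m+z)}}$. Assume $[k]\ne0$ for all integers $k\ge1$. The weights are $w_a(u)=\theta_{a+1}(u|\tau)/\theta_{a+1}(\eta|\tau)$ and $$\mathbf S^a=\frac{i^{\delta_{a,2}}\theta_{a+1}(\eta|\tau)}{\theta_1(2\eta z|\tau)}\Big(\theta_{a+1}(2\eta(z-\ell)|\tau)\,e^{\partial}-\theta_{a+1}(-2\eta(z+\ell)|\tau)\,e^{-\partial}\Big).$$ Operators are formal series $\sum_{k\ge0}t_k(z)e^{(b-2k)\partial}$ with meromorphic coefficients on $\mathbb C$, multiplied by the rule $e^{r\partial}f(z)=f(z+r)e^{r\partial}$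 and compared coefficientwise as meromorphic functions. **Proposition.** For $a\in\mathbb C$ let $$W_o(a)=z^{-a}\,\frac{\Gamma(z\partial+1)}{\Gamma(z\partial+1-a)},\qquad W_q(a)=q^{a^2/2}\,z^{-a}\,\frac{(q^{2z\partial+2-2a};q^2)}{(q^{2z\partial+2};q^2)}\,q^{-az\partial},$$ $$W_e(a)=e^{2\pi i a\eta z+\pi i\eta a^2}\frac{\gamma(2z)}{\gamma(2z+2a)}\sum_{k=0}^\infty\frac{[-z-a+2k]\,[-z-a]_k\,[-a]_k}{[-z-a]\,[-z+1]_k\,[k]!}\,e^{(a-2k)\partial}.$$ The coefficients of $W_e(a)$ are meromorphic. In each case, for all $u_1,u_2\in\mathbb C$, the operator $W=W(u_1-u_2)$, which depends only on $a=u_1-u_2$, satisfies $$W\,\mathrm L(u_1,u_2)=\mathrm L(u_2,u_1)\,W ,$$ and for every $\ell\in\mathbb C$ the operator $W=W(2\ell+1)$ satisfies $W\,\mathbf S^a_\ell=\mathbf S^a_{-1-\ell}\,W$, $a=0,1,2,3$. Here in case 1 the relations hold on $V_\lambda$ for every $\lambda\notin\mathbb Z$; in case 2 they hold on $V_\lambda$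 for every $\lambda$ with $q^{2(\lambda+n)}\neq1$ for all $n\in\mathbb Z$; in case 3 they hold as identities of formal series. Moreover the relation with the Lax matrix determines $W$ up to normalization for generic parameters. Let $a=u_1-u_2$ and let $T$ satisfy $T\,\mathrm L(u_1,u_2)=\mathrm L(u_2,u_1)\,T$. * Case 1: let $\lambda\notin\mathbb Z$ and $\lambda-a\notin\mathbb Z$, and let $T$ be linear and satisfy the relation on $V_\lambda$. Then $T=c\,W_o(a)$ on $V_\lambda$ for some $c\in\mathbb C$. * Case 2: let $q^{2(\lambda+n)}\ne1$ and $q^{2(\lambda-a+n)}\neq1$ for all $n\in\mathbb Z$, let $w_c(u)\ne0$ for $c=0,1,2,3$, and let $T$ be linear, map $V_\lambda$ into $V_{\lambda-a}$, and satisfy the relation on $V_\lambda$. Then $T=c\,W_q(a)$ on $V_\lambda$ for some $c\in\mathbb C$. * Case 3: let $w_c(u)\neq0$ for $c=0,1,2,3$, and let $T=\sum_{k\ge0}t_k(z)e^{(a-2k)\partial}$ with meromorphic $t_k$. Then $T=p(z)\,W_e(a)$ for some meromorphic $p$ with $p(z+1)=p(z)$. -/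

import Mathlib

noncomputable section

namespace YangBaxter

/-! ### Lax matrices -/

/-- The Pauli matrices, with `pauli 0` the identity. -/
def pauli : Fin 4 → Matrix (Fin 2) (Fin 2) ℂ :=
  ![1, !![0, 1; 1, 0], !![0, -Complex.I; Complex.I, 0], !![1, 0; 0, -1]]

/-- `(1/2) ∑ₐ wₐ σᵃ ⊗ Sᵃ`: the Lax matrix with weights `wₐ` and generators `Sᵃ`. -/
def lax {A : Type*} [AddCommGroup A] [Module ℂ A] (w : Fin 4 → ℂ) (S : Fin 4 → A) :
    Matrix (Fin 2) (Fin 2) A :=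
  fun i j => (1 / 2 : ℂ) • ∑ a : Fin 4, (w a * pauli a i j) • S a

/-! ### The Heisenberg pair `z`, `∂` on sums of complex powers of `z` -/

/-- Finite linear combinations of formal powers `z ^ x`, `x ∈ ℂ`;
`Finsupp.single x c` stands for `c z ^ x`. -/
abbrev PowerSums : Type := ℂ →₀ ℂ

/-- Multiplication by `z ^ b`. -/
def zPow (b : ℂ) : Module.End ℂ PowerSums :=
  Finsupp.linearCombination ℂ (fun x : ℂ => Finsupp.single (x + b) (1 : ℂ))

/-- The derivation `∂ : z ^ x ↦ x z ^ (x - 1)`. -/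
def del : Module.End ℂ PowerSums :=
  Finsupp.linearCombination ℂ (fun x : ℂ => Finsupp.single (x - 1) x)

/-- The function `Φ(z∂)` of the Euler operator: `z ^ x ↦ Φ(x) z ^ x`. -/
def funEuler (Φ : ℂ → ℂ) : Module.End ℂ PowerSums :=
  Finsupp.linearCombination ℂ (fun x : ℂ => Finsupp.single x (Φ x))

theorem zPow_mul_del : zPow 1 * del = funEuler (fun x => x) := by
  ext x : 2
  simp [zPow, del, funEuler]

/-- The span of the powers `z ^ (lam + n)`, `n ∈ ℤ`. -/
def powerModule (lam : ℂ) : Submodule ℂ PowerSums :=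
  Finsupp.supported ℂ ℂ (Set.range fun n : ℤ => lam + (n : ℂ))

/-- The matrix relation `T L = L' T` on the subspace `V`. -/
def LaxRelOn (V : Submodule ℂ PowerSums) (T : Module.End ℂ PowerSums)
    (L L' : Matrix (Fin 2) (Fin 2) (Module.End ℂ PowerSums)) : Prop :=
  ∀ i j : Fin 2, ∀ f ∈ V, (T * L i j) f = (L' i j * T) f

/-! ### No deformation -/

def weightO (u : ℂ) : Fin 4 → ℂ := ![2 * u, 1, 1, 1]

def minusO : Module.End ℂ PowerSums := -del

def zeroO (l : ℂ) : Module.End ℂ PowerSums := zPow 1 * del - l • 1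

def plusO (l : ℂ) : Module.End ℂ PowerSums := zPow 2 * del - (2 * l) • zPow 1

/-- The generators `𝐒⁰ = 1`, `𝐒¹ ± i𝐒² = 2S^±`, `𝐒³ = 2S` in the representation of spin `l`. -/
def genO (l : ℂ) : Fin 4 → Module.End ℂ PowerSums :=
  ![1, plusO l + minusO, (-Complex.I) • (plusO l - minusO), (2 : ℂ) • zeroO l]

/-- The Lax matrix in terms of `u₁ = u + l`, `u₂ = u - 1 - l`. -/
def laxO (u₁ u₂ : ℂ) : Matrix (Fin 2) (Fin 2) (Module.End ℂ PowerSums) :=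
  lax (weightO ((u₁ + u₂ + 1) / 2)) (genO ((u₁ - u₂ - 1) / 2))

/-- `W(a) = z ^ (-a) Γ(z∂ + 1) / Γ(z∂ + 1 - a)`. -/
def interO (a : ℂ) : Module.End ℂ PowerSums :=
  zPow (-a) * funEuler (fun x => Complex.Gamma (x + 1) / Complex.Gamma (x + 1 - a))

/-! ### q-deformation, with `q = exp h` -/

/-- `q ^ x`, where `h` is the chosen logarithm of `q`. -/
def qpow (h x : ℂ) : ℂ := Complex.exp (h * x)

/-- The q-number `[x]_q = (q ^ x - q ^ (-x)) / (q - q⁻¹)`. -/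
def qnum (h x : ℂ) : ℂ := (qpow h x - qpow h (-x)) / (qpow h 1 - qpow h (-1))

/-- The infinite product `(y; q²) = ∏_{k ≥ 0} (1 - y q ^ (2k))`. -/
def qPoch (h y : ℂ) : ℂ := ∏' k : ℕ, (1 - y * qpow h (2 * (k : ℂ)))

def weightQ (h u : ℂ) : Fin 4 → ℂ :=
  ![(qpow h u - qpow h (-u)) / (qpow h (1 / 2) - qpow h (-(1 / 2))), 1, 1,
    (qpow h u + qpow h (-u)) / (qpow h (1 / 2) + qpow h (-(1 / 2)))]

/-- `S⁻ = -z⁻¹ [z∂]_q`. -/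
def minusQ (h : ℂ) : Module.End ℂ PowerSums := -(zPow (-1) * funEuler (fun x => qnum h x))

/-- `S⁺ = z [z∂ - 2l]_q`. -/
def plusQ (h l : ℂ) : Module.End ℂ PowerSums := zPow 1 * funEuler (fun x => qnum h (x - 2 * l))

/-- The generators `𝐒⁰`, `𝐒¹ ± i𝐒² = 2S^±`, `𝐒³` in the representation of spin `l`, where
`𝐒⁰ = (q^S + q^(-S)) / (q^(1/2) + q^(-1/2))`, `𝐒³ = (q^S - q^(-S)) / (q^(1/2) - q^(-1/2))` and
`S = z∂ - l`. -/
def genQ (h l : ℂ) : Fin 4 → Module.End ℂ PowerSums :=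
  ![funEuler (fun x => (qpow h (x - l) + qpow h (-(x - l))) /
        (qpow h (1 / 2) + qpow h (-(1 / 2)))),
    plusQ h l + minusQ h,
    (-Complex.I) • (plusQ h l - minusQ h),
    funEuler (fun x => (qpow h (x - l) - qpow h (-(x - l))) /
        (qpow h (1 / 2) - qpow h (-(1 / 2))))]

/-- The Lax matrix in terms of `u₁ = u + l`, `u₂ = u - 1 - l`. -/
def laxQ (h u₁ u₂ : ℂ) : Matrix (Fin 2) (Fin 2) (Module.End ℂ PowerSums) :=
  lax (weightQ h ((u₁ + u₂ + 1) / 2)) (genQ h ((u₁ - u₂ - 1) / 2))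

/-- `W(a) = q ^ (a²/2) z ^ (-a) (q ^ (2z∂ + 2 - 2a); q²) / (q ^ (2z∂ + 2); q²) q ^ (-a z∂)`. -/
def interQ (h a : ℂ) : Module.End ℂ PowerSums :=
  qpow h (a ^ 2 / 2) • (zPow (-a) *
    funEuler (fun x => qPoch h (qpow h (2 * x + 2 - 2 * a)) / qPoch h (qpow h (2 * x + 2))) *
    funEuler (fun x => qpow h (-(a * x))))

/-! ### Elliptic deformation -/

/-- The theta function with characteristics. -/
def thetaChar (a b τ z : ℂ) : ℂ :=
  ∑' n : ℤ, Complex.exp (Real.pi * Complex.I * ((n : ℂ) + a) ^ 2 * τ +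
    2 * Real.pi * Complex.I * ((n : ℂ) + a) * (z + b))

/-- `theta τ a z` is `θ_{a+1}(z|τ)`, `a = 0, 1, 2, 3`. -/
def theta (τ : ℂ) : Fin 4 → ℂ → ℂ :=
  ![thetaChar (1 / 2) (1 / 2) τ, thetaChar (1 / 2) 0 τ, thetaChar 0 0 τ, thetaChar 0 (1 / 2) τ]

/-- The elliptic number `[x] = θ₁(2ηx|τ)`. -/
def ell (τ η x : ℂ) : ℂ := theta τ 0 (2 * η * x)

/-- `[x]_k = [x] [x+1] ⋯ [x+k-1]`. -/
def ellPoch (τ η x : ℂ) (k : ℕ) : ℂ := ∏ j ∈ Finset.range k, ell τ η (x + (j : ℂ))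

/-- `[k]! = [1] [2] ⋯ [k]`. -/
def ellFact (τ η : ℂ) (k : ℕ) : ℂ := ∏ j ∈ Finset.range k, ell τ η ((j : ℂ) + 1)

/-- The elliptic gamma function `Γ(z|τ,τ')`. -/
def ellGamma (τ τ' z : ℂ) : ℂ :=
  (∏' p : ℕ × ℕ, (1 - Complex.exp (2 * Real.pi * Complex.I *
      (τ * ((p.1 : ℂ) + 1) + τ' * ((p.2 : ℂ) + 1) - z)))) /
  (∏' p : ℕ × ℕ, (1 - Complex.exp (2 * Real.pi * Complex.I *
      (τ * (p.1 : ℂ) + τ' * (p.2 : ℂ) + z))))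

/-- `γ(z) = Γ(ηz|τ,2η)`. -/
def gam (τ η z : ℂ) : ℂ := ellGamma τ (2 * η) (η * z)

/-- Coefficients of a formal difference operator `∑_{k ≥ 0} t k (z) e^{(b-2k)∂}`, whose leading
exponent `b` is passed separately; `e^{∂}` is the shift `z ↦ z + 1`. -/
abbrev ShiftCoeffs : Type := ℕ → ℂ → ℂ

/-- Coefficients of the product of `∑ t k (z) e^{(b-2k)∂}` with `∑ s j (z) e^{(c-2j)∂}`, a series
with leading exponent `b + c`, by the rule `e^{r∂} f(z) = f(z+r) e^{r∂}`. -/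
def shiftMul (b : ℂ) (t s : ShiftCoeffs) : ShiftCoeffs :=
  fun n z => ∑ k ∈ Finset.range (n + 1), t k z * s (n - k) (z + b - 2 * (k : ℂ))

/-- Equality of all the coefficients as meromorphic functions: pointwise off a closed discrete
set. -/
def ShiftEq (t s : ShiftCoeffs) : Prop :=
  ∀ n : ℕ, t n =ᶠ[Filter.codiscrete ℂ] s n

def weightE (τ η u : ℂ) : Fin 4 → ℂ := fun a => theta τ a u / theta τ a η

/-- The generators of the Sklyanin algebra in the representation of spin `l`, as operators with
leading exponent `1`:
`i^{δ_{a,2}} θ_{a+1}(η) / θ₁(2ηz) (θ_{a+1}(2η(z-l)) e^{∂} - θ_{a+1}(-2η(z+l)) e^{-∂})`. -/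
def genE (τ η l : ℂ) : Fin 4 → ShiftCoeffs := fun a n z =>
  (if a = 2 then Complex.I else 1) * theta τ a η / theta τ 0 (2 * η * z) *
    (if n = 0 then theta τ a (2 * η * (z - l))
      else if n = 1 then -theta τ a (-(2 * η * (z + l)))
      else 0)

/-- The Lax matrix in terms of `u₁ = u/(2η) + l`, `u₂ = u/(2η) - 1 - l`; its entries have leading
exponent `1`. -/
def laxE (τ η u₁ u₂ : ℂ) : Matrix (Fin 2) (Fin 2) ShiftCoeffs :=
  lax (weightE τ η (η * (u₁ + u₂ + 1))) (genE τ η ((u₁ - u₂ - 1) / 2))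

/-- The matrix relation `T L = L' T`, where `T` has leading exponent `b` and the entries of `L`
and `L'` have leading exponent `1`. -/
def LaxRelShift (b : ℂ) (T : ShiftCoeffs) (L L' : Matrix (Fin 2) (Fin 2) ShiftCoeffs) : Prop :=
  ∀ i j : Fin 2, ShiftEq (shiftMul b T (L i j)) (shiftMul 1 (L' i j) T)

/-- The coefficients of the elliptic operator `W(a)`, a series with leading exponent `a`. -/
def interE (τ η a : ℂ) : ShiftCoeffs := fun k z =>
  Complex.exp (2 * Real.pi * Complex.I * a * η * z + Real.pi * Complex.I * η * a ^ 2) *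
      gam τ η (2 * z) / gam τ η (2 * z + 2 * a) *
    (ell τ η (-z - a + 2 * (k : ℂ)) * ellPoch τ η (-z - a) k * ellPoch τ η (-a) k /
      (ell τ η (-z - a) * ellPoch τ η (-z + 1) k * ellFact τ η k))

end YangBaxter

end

open Filter Topology

namespace YangBaxter

/-! ### Linearity of the Lax matrix in the generators -/

/-! Exchanging `u₁` and `u₂` fixes `u₁ + u₂`, so both Lax matrices have the same weights and differ
only in the spin, `l` against `-1 - l`. Since the Pauli matrices are linearly independent, the
matrix relation splits into the four relations `T Sᶜ_l = Sᶜ_{-1-l} T`, each multiplied by its weight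
(`smul_eq_smul_of_lax_eq`).

In the first two cases `W` sends `z ^ x` to `ρ(x) z ^ (x - a)`. The diagonal generators are matched
by this shift of degree alone, and lowering and raising operators give one and the same recurrence
`N(x) ρ(x - 1) = N(x - a) ρ(x)`, with `N(x) = x` or `[x]_q`. The Gamma quotient and the quotient of
q-products solve it. Conversely, commutation with the diagonal generators forces `T` to send each
monomial to a multiple of one monomial, and the recurrence, whose coefficients do not vanish, fixes
the multiples up to one constant (`eq_const_smul_of_lowering`).

In the elliptic case, comparing coefficients at order `n + 1` gives, for each `c`, a relation
between four values `θ_c(2sᵢ)` with `s₁ + s₂ + s₃ + s₄ = 0`. Such vectors are linearly dependent,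
with products of values of `θ₁` at the differences `sᵢ - sⱼ` as coefficients (`sum_theta_eq_zero`).
The series in `W` has the coefficient ratios that produce these products (`eventually_interE_succ`,
`eventually_interE_add_one`); its elliptic gamma prefactor settles order zero, through the product
expansion of `θ₁` (`exists_theta_zero_eq`). For uniqueness, order zero makes the quotient `p` of the
leading coefficients 1-periodic. At each later order the discrepancy between `T` and `p W` yields
two proportional theta vectors, and generic ones are not proportional (`eq_zero_of_mul_theta_eq`).
-/

theorem map_lax {A B : Type*} [AddCommGroup A] [Module ℂ A] [AddCommGroup B] [Module ℂ B]
    (φ : A →ₗ[ℂ] B) (w : Fin 4 → ℂ) (S : Fin 4 → A) (i j : Fin 2) :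
    φ (lax w S i j) = lax w (fun c => φ (S c)) i j := by
  simp [lax, map_sum]

theorem lax_congr {A : Type*} [AddCommGroup A] [Module ℂ A] {w : Fin 4 → ℂ} {x y : Fin 4 → A}
    (h : ∀ c, x c = y c) (i j : Fin 2) : lax w x i j = lax w y i j := by
  rw [funext h]

/-- Each Pauli component is recovered as a combination of two matrix entries: sum and difference of
the diagonal ones for `c = 0, 3`, of the off-diagonal ones for `c = 1, 2`. The weights stay in the
conclusion, so that no nonvanishing is needed here. -/
theorem smul_eq_smul_of_lax_eq {A : Type*} [AddCommGroup A] [Module ℂ A] {w : Fin 4 → ℂ}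
    {x y : Fin 4 → A} (h : ∀ i j, lax w x i j = lax w y i j) (c : Fin 4) :
    w c • x c = w c • y c := by
  have h00 := h 0 0
  have h01 := h 0 1
  have h10 := h 1 0
  have h11 := h 1 1
  simp only [lax, pauli, Fin.sum_univ_four, Matrix.cons_val_zero, Matrix.cons_val_one,
    Matrix.cons_val, Matrix.of_apply, Matrix.one_apply_eq, Matrix.cons_val', Matrix.cons_val_fin_one,
    mul_one, mul_zero, zero_smul, add_zero, Matrix.one_apply] at h00 h01 h10 h11
  simp only [Fin.isValue, zero_ne_one, one_ne_zero, if_false, mul_zero, zero_smul, zero_add]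
    at h01 h10
  have hI : Complex.I * Complex.I = -1 := Complex.I_mul_I
  fin_cases c
  · show w 0 • x 0 = w 0 • y 0
    linear_combination (norm := module) h00 + h11
  · show w 1 • x 1 = w 1 • y 1
    linear_combination (norm := module) h01 + h10
  · show w 2 • x 2 = w 2 • y 2
    have := congrArg₂ (fun a b => Complex.I • (a - b)) h01 h10
    simp only [smul_add, smul_sub, smul_smul] at this
    have e1 : Complex.I * (1 / 2 * (w 2 * -Complex.I)) = (1 / 2) * w 2 := by
      linear_combination (-(1 / 2) * w 2) * hI
    have e2 : Complex.I * (1 / 2 * (w 2 * Complex.I)) = -((1 / 2) * w 2) := by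
      linear_combination ((1 / 2) * w 2) * hI
    rw [e1, e2] at this
    linear_combination (norm := module) this
  · show w 3 • x 3 = w 3 • y 3
    linear_combination (norm := module) h00 - h11

/-! ### Operators on sums of powers -/

@[simp] theorem zPow_single (b x c : ℂ) :
    zPow b (Finsupp.single x c) = Finsupp.single (x + b) c := by
  simp [zPow]

@[simp] theorem del_single (x c : ℂ) :
    del (Finsupp.single x c) = Finsupp.single (x - 1) (c * x) := by
  simp [del]

@[simp] theorem funEuler_single (Φ : ℂ → ℂ) (x c : ℂ) :
    funEuler Φ (Finsupp.single x c) = Finsupp.single x (c * Φ x) := by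
  simp [funEuler]

theorem single_mem_powerModule (lam : ℂ) (n : ℤ) (c : ℂ) :
    Finsupp.single (lam + n) c ∈ powerModule lam :=
  Finsupp.single_mem_supported ℂ c ⟨n, rfl⟩

theorem eq_on_powerModule {lam : ℂ} {F G : Module.End ℂ PowerSums}
    (h : ∀ n : ℤ, F (Finsupp.single (lam + n) 1) = G (Finsupp.single (lam + n) 1)) :
    ∀ f ∈ powerModule lam, F f = G f := by
  intro f hf
  rw [powerModule, Finsupp.supported_eq_span_single] at hf
  refine LinearMap.eqOn_span ?_ hf
  rintro _ ⟨_, ⟨n, rfl⟩, rfl⟩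
  exact h n

theorem laxRelOn_of_gen {V : Submodule ℂ PowerSums} {T : Module.End ℂ PowerSums}
    {w : Fin 4 → ℂ} {S S' : Fin 4 → Module.End ℂ PowerSums}
    (h : ∀ c, ∀ f ∈ V, (T * S c) f = (S' c * T) f) : LaxRelOn V T (lax w S) (lax w S') := by
  intro i j f hf
  have h1 := map_lax (LinearMap.applyₗ (R := ℂ) f ∘ₗ LinearMap.mulLeft ℂ T) w S i j
  have h2 := map_lax (LinearMap.applyₗ (R := ℂ) f ∘ₗ LinearMap.mulRight ℂ T) w S' i j
  simp only [LinearMap.comp_apply, LinearMap.applyₗ_apply_apply, LinearMap.mulLeft_apply,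
    LinearMap.mulRight_apply] at h1 h2
  rw [h1, h2]
  exact lax_congr (fun c => h c f hf) i j

theorem smul_gen_of_laxRelOn {V : Submodule ℂ PowerSums} {T : Module.End ℂ PowerSums}
    {w : Fin 4 → ℂ} {S S' : Fin 4 → Module.End ℂ PowerSums}
    (h : LaxRelOn V T (lax w S) (lax w S')) (c : Fin 4) {f : PowerSums} (hf : f ∈ V) :
    w c • (T * S c) f = w c • (S' c * T) f := by
  refine smul_eq_smul_of_lax_eq (x := fun c => (T * S c) f) (y := fun c => (S' c * T) f) ?_ c
  intro i j
  have h1 := map_lax (LinearMap.applyₗ (R := ℂ) f ∘ₗ LinearMap.mulLeft ℂ T) w S i j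
  have h2 := map_lax (LinearMap.applyₗ (R := ℂ) f ∘ₗ LinearMap.mulRight ℂ T) w S' i j
  simp only [LinearMap.comp_apply, LinearMap.applyₗ_apply_apply, LinearMap.mulLeft_apply,
    LinearMap.mulRight_apply] at h1 h2
  rw [← h1, ← h2]
  exact h i j f hf

/-- A two-sided sequence is determined up to a factor by a first order recurrence whose
coefficients do not vanish. -/
theorem eq_const_mul_of_recurrence {α β t s : ℤ → ℂ} (hα : ∀ n, α n ≠ 0) (hβ : ∀ n, β n ≠ 0)
    (ht : ∀ n, α n * t (n - 1) = β n * t n) (hs : ∀ n, α n * s (n - 1) = β n * s n)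
    (hs0 : s 0 ≠ 0) : ∀ n, t n = t 0 / s 0 * s n := by
  intro n
  induction n using Int.induction_on with
  | zero => field_simp
  | succ k ih =>
    have h1 := ht (k + 1)
    have h2 := hs (k + 1)
    rw [add_sub_cancel_right] at h1 h2
    apply mul_left_cancel₀ (hβ (k + 1))
    rw [← h1, ih]
    linear_combination (t 0 / s 0) * h2
  | pred k ih =>
    have h1 := ht (-k)
    have h2 := hs (-k)
    apply mul_left_cancel₀ (hα (-k))
    rw [h1, ih]
    linear_combination -(t 0 / s 0) * h2

/-! ### Operators that shift the degree by a constant -/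

section Intertwining

variable {a lam : ℂ} {N ρ : ℂ → ℂ} {T : Module.End ℂ PowerSums}

theorem intertwine_lowering (hT : ∀ x c, T (Finsupp.single x c) = Finsupp.single (x - a) (c * ρ x))
    (hρ : ∀ n : ℤ, N (lam + n) * ρ (lam + n - 1) = N (lam + n - a) * ρ (lam + n))
    {M : Module.End ℂ PowerSums}
    (hM : ∀ x c, M (Finsupp.single x c) = Finsupp.single (x - 1) (c * -N x)) :
    ∀ f ∈ powerModule lam, (T * M) f = (M * T) f := by
  refine eq_on_powerModule fun n => ?_
  simp only [Module.End.mul_apply, hT, hM]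
  rw [show lam + (n : ℂ) - 1 - a = lam + n - a - 1 by ring]
  congr 1
  linear_combination -hρ n

/-- The recurrence `hρ` at `n + 1` is exactly what is needed: with `x = lam + n` one has `x - 2l = x
+ 1 - a` and `(x - a) - 2l' = x + 1`, so the two raising factors are the two lowering factors one
degree higher. -/
theorem intertwine_raising (hT : ∀ x c, T (Finsupp.single x c) = Finsupp.single (x - a) (c * ρ x))
    (hρ : ∀ n : ℤ, N (lam + n) * ρ (lam + n - 1) = N (lam + n - a) * ρ (lam + n))
    {l l' : ℂ} (hl : a = 2 * l + 1) (hl' : l' = -1 - l) {P P' : Module.End ℂ PowerSums}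
    (hP : ∀ x c, P (Finsupp.single x c) = Finsupp.single (x + 1) (c * N (x - 2 * l)))
    (hP' : ∀ x c, P' (Finsupp.single x c) = Finsupp.single (x + 1) (c * N (x - 2 * l'))) :
    ∀ f ∈ powerModule lam, (T * P) f = (P' * T) f := by
  refine eq_on_powerModule fun n => ?_
  simp only [Module.End.mul_apply, hT, hP, hP']
  have h := hρ (n + 1)
  push_cast at h
  rw [show lam + ((n : ℂ) + 1) - 1 = lam + n by ring,
    show lam + ((n : ℂ) + 1) - a = lam + n - 2 * l by rw [hl]; ring] at h
  rw [show lam + (n : ℂ) + 1 - a = lam + n - a + 1 by ring,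
    show lam + (n : ℂ) - a - 2 * l' = lam + (n + 1) by rw [hl, hl']; ring,
    show lam + (n : ℂ) + 1 = lam + (n + 1) by ring]
  congr 1
  linear_combination -h

/-- No condition on `ρ` arises, because `a = l - l'` gives `(x - a) - l' = x - l`. -/
theorem intertwine_diagonal (hT : ∀ x c, T (Finsupp.single x c) = Finsupp.single (x - a) (c * ρ x))
    {l l' : ℂ} (hl : a = 2 * l + 1) (hl' : l' = -1 - l) {Φ : ℂ → ℂ} {D D' : Module.End ℂ PowerSums}
    (hD : ∀ x c, D (Finsupp.single x c) = Finsupp.single x (c * Φ (x - l)))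
    (hD' : ∀ x c, D' (Finsupp.single x c) = Finsupp.single x (c * Φ (x - l'))) :
    ∀ f ∈ powerModule lam, (T * D) f = (D' * T) f := by
  refine eq_on_powerModule fun n => ?_
  simp only [Module.End.mul_apply, hT, hD, hD']
  rw [show lam + (n : ℂ) - a - l' = lam + n - l by rw [hl, hl']; ring]
  congr 1
  ring

/-- An operator which shifts the degree by `-a` and commutes with the lowering operator is
determined on `powerModule lam` up to a constant. -/
theorem eq_const_smul_of_lowering
    (hT : ∀ x c, T (Finsupp.single x c) = Finsupp.single (x - a) (c * ρ x))
    (hρ : ∀ n : ℤ, N (lam + n) * ρ (lam + n - 1) = N (lam + n - a) * ρ (lam + n))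
    (hN : ∀ n : ℤ, N (lam + n) ≠ 0) (hN' : ∀ n : ℤ, N (lam + n - a) ≠ 0) (hρ0 : ρ lam ≠ 0)
    {M : Module.End ℂ PowerSums}
    (hM : ∀ x c, M (Finsupp.single x c) = Finsupp.single (x - 1) (c * -N x))
    {U : Module.End ℂ PowerSums} (hU : ∀ f ∈ powerModule lam, U (M f) = M (U f)) {t : ℤ → ℂ}
    (hUt : ∀ n : ℤ, U (Finsupp.single (lam + n) 1) = Finsupp.single (lam + n - a) (t n)) :
    ∃ c : ℂ, ∀ f ∈ powerModule lam, U f = c • T f := by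
  have hUt' : ∀ (n : ℤ) (c : ℂ),
      U (Finsupp.single (lam + n) c) = Finsupp.single (lam + n - a) (c * t n) := by
    intro n c
    rw [show Finsupp.single (lam + (n : ℂ)) c = c • Finsupp.single (lam + (n : ℂ)) (1 : ℂ) by simp,
      map_smul, hUt]
    simp
  have ht : ∀ n : ℤ, N (lam + n) * t (n - 1) = N (lam + n - a) * t n := by
    intro n
    have h := hU _ (single_mem_powerModule lam n 1)
    rw [hM, hUt', hM, show lam + (n : ℂ) - 1 = lam + ((n - 1 : ℤ) : ℂ) by push_cast; ring, hUt',
      show lam + ((n - 1 : ℤ) : ℂ) - a = lam + n - a - 1 by push_cast; ring] at h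
    have h := Finsupp.single_injective _ h
    linear_combination -h
  have hs : ∀ n : ℤ, N (lam + n) * ρ (lam + (n - 1 : ℤ)) = N (lam + n - a) * ρ (lam + n) := by
    intro n
    rw [← hρ n]
    push_cast
    ring_nf
  refine ⟨t 0 / ρ (lam + (0 : ℤ)), ?_⟩
  have key := eq_const_mul_of_recurrence (t := t) (s := fun n => ρ (lam + n)) hN hN' ht hs
    (by simpa using hρ0)
  have := eq_on_powerModule (lam := lam) (F := U) (G := (t 0 / ρ (lam + (0 : ℤ))) • T) ?_
  · simpa using this
  · intro n
    rw [hUt, key, LinearMap.smul_apply, hT]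
    simp

end Intertwining

/-- A sum of powers on which an operator of the form `Φ(z∂)` acts as a scalar is a multiple of
`z ^ y` when `Φ` takes that scalar, on the support, at `y` only. -/
theorem eq_single_of_funEuler_eigen {Φ : ℂ → ℂ} {g : PowerSums} {y : ℂ}
    (h : funEuler Φ g = Φ y • g) (hinj : ∀ x ∈ g.support, Φ x = Φ y → x = y) :
    g = Finsupp.single y (g y) := by
  have happ : ∀ x, funEuler Φ g x = g x * Φ x := by
    intro x
    rw [funEuler, Finsupp.linearCombination_apply, Finsupp.sum, Finsupp.finsetSum_apply]
    simp only [Finsupp.smul_apply, Finsupp.single_apply, smul_eq_mul, mul_ite, mul_zero]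
    rw [Finset.sum_ite_eq']
    split_ifs with hx
    · rfl
    · rw [Finsupp.notMem_support_iff.mp hx, zero_mul]
  ext x
  rw [Finsupp.single_apply]
  split_ifs with hx
  · rw [hx]
  · by_contra hg
    have h1 := happ x
    rw [h, Finsupp.smul_apply, smul_eq_mul, mul_comm] at h1
    exact hx (hinj x (Finsupp.mem_support_iff.mpr hg) (mul_left_cancel₀ hg h1).symm).symm

/-! ### The undeformed operator -/

theorem minusO_single (x c : ℂ) :
    minusO (Finsupp.single x c) = Finsupp.single (x - 1) (c * -x) := by
  simp [minusO]

theorem plusO_single (l x c : ℂ) :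
    plusO l (Finsupp.single x c) = Finsupp.single (x + 1) (c * (x - 2 * l)) := by
  simp only [plusO, LinearMap.sub_apply, Module.End.mul_apply, LinearMap.smul_apply, del_single,
    zPow_single, Finsupp.smul_single, smul_eq_mul]
  rw [show x - 1 + 2 = x + 1 by ring, ← Finsupp.single_sub]
  congr 1
  ring

theorem zeroO_single (l x c : ℂ) :
    zeroO l (Finsupp.single x c) = Finsupp.single x (c * (x - l)) := by
  simp only [zeroO, LinearMap.sub_apply, Module.End.mul_apply, LinearMap.smul_apply, del_single,
    zPow_single, Finsupp.smul_single, smul_eq_mul, Module.End.one_apply]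
  rw [show x - 1 + 1 = x by ring, ← Finsupp.single_sub]
  congr 1
  ring

theorem interO_single (a x c : ℂ) :
    interO a (Finsupp.single x c) =
      Finsupp.single (x - a) (c * (Complex.Gamma (x + 1) / Complex.Gamma (x + 1 - a))) := by
  rw [interO, Module.End.mul_apply, funEuler_single, zPow_single, sub_eq_add_neg x a]

/-- The denominator is handled through `1/Γ`, whose functional equation holds everywhere; hence only
`x`, and not `x - a`, has to be nonzero. -/
theorem mul_Gamma_div_Gamma (a : ℂ) {x : ℂ} (hx : x ≠ 0) :
    x * (Complex.Gamma (x - 1 + 1) / Complex.Gamma (x - 1 + 1 - a)) =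
      (x - a) * (Complex.Gamma (x + 1) / Complex.Gamma (x + 1 - a)) := by
  rw [sub_add_cancel, div_eq_mul_inv, div_eq_mul_inv, Complex.Gamma_add_one x hx]
  have h := Complex.one_div_Gamma_eq_self_mul_one_div_Gamma_add_one (x - a)
  rw [show x - a + 1 = x + 1 - a by ring] at h
  rw [h]
  ring

theorem interO_gen {lam : ℂ} (hlam : ∀ n : ℤ, lam ≠ n) {l l' : ℂ} (hl' : l' = -1 - l) (c : Fin 4) :
    ∀ f ∈ powerModule lam, (interO (2 * l + 1) * genO l c) f = (genO l' c * interO (2 * l + 1)) f := by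
  have hρ : ∀ n : ℤ, (lam + n) * (Complex.Gamma (lam + n - 1 + 1) /
      Complex.Gamma (lam + n - 1 + 1 - (2 * l + 1))) = (lam + n - (2 * l + 1)) *
      (Complex.Gamma (lam + n + 1) / Complex.Gamma (lam + n + 1 - (2 * l + 1))) := by
    refine fun n => mul_Gamma_div_Gamma _ fun h => hlam (-n) ?_
    push_cast
    linear_combination h
  have hT := interO_single (2 * l + 1)
  have hM := intertwine_lowering (N := id) hT hρ minusO_single
  have hP := intertwine_raising (N := id) hT hρ rfl hl' (plusO_single l) (plusO_single l')
  have hD := intertwine_diagonal (lam := lam) (Φ := id) hT rfl hl' (zeroO_single l)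
    (zeroO_single l')
  intro f hf
  have hM := hM f hf
  have hP := hP f hf
  have hD := hD f hf
  simp only [Module.End.mul_apply] at hM hP hD ⊢
  fin_cases c
  · simp [genO]
  · simp [genO, hM, hP]
  · simp [genO, hM, hP]
  · simp [genO, hD]

theorem interO_laxRelOn {lam : ℂ} (hlam : ∀ n : ℤ, lam ≠ n) (u₁ u₂ : ℂ) :
    LaxRelOn (powerModule lam) (interO (u₁ - u₂)) (laxO u₁ u₂) (laxO u₂ u₁) := by
  rw [laxO, laxO, add_comm u₂ u₁]
  refine laxRelOn_of_gen fun c => ?_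
  have h := interO_gen hlam (l := (u₁ - u₂ - 1) / 2) (l' := (u₂ - u₁ - 1) / 2) (by ring) c
  rwa [show 2 * ((u₁ - u₂ - 1) / 2) + 1 = u₁ - u₂ by ring] at h

/-- Only `S⁻` and `S` are used, and they come from the components `c = 1, 2, 3`, whose weights equal
`1`; therefore `u` is unrestricted. -/
theorem interO_unique {lam : ℂ} (hlam : ∀ n : ℤ, lam ≠ n) {u₁ u₂ : ℂ}
    (ha : ∀ n : ℤ, lam - (u₁ - u₂) ≠ n) {T : Module.End ℂ PowerSums}
    (hT : LaxRelOn (powerModule lam) T (laxO u₁ u₂) (laxO u₂ u₁)) :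
    ∃ c : ℂ, ∀ f ∈ powerModule lam, T f = c • interO (u₁ - u₂) f := by
  rw [laxO, laxO, add_comm u₂ u₁] at hT
  have hgen := fun c {f : PowerSums} (hf : f ∈ powerModule lam) => smul_gen_of_laxRelOn hT c hf
  set a := u₁ - u₂ with ha_def
  have hminus : ∀ f ∈ powerModule lam, T (minusO f) = minusO (T f) := by
    intro f hf
    have h1 := hgen 1 hf
    have h2 := hgen 2 hf
    simp only [weightO, genO, Matrix.cons_val_one, Matrix.cons_val, one_smul, Module.End.mul_apply,
      LinearMap.add_apply, LinearMap.sub_apply, LinearMap.smul_apply, map_add, map_sub,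
      map_smul] at h1 h2
    have h2 := smul_right_injective _ (neg_ne_zero.mpr Complex.I_ne_zero) h2
    have h3 : (2 : ℂ) • T (minusO f) = (2 : ℂ) • minusO (T f) := by
      linear_combination (norm := module) h1 - h2
    exact smul_right_injective _ two_ne_zero h3
  have hzero : ∀ f ∈ powerModule lam,
      T (zeroO ((u₁ - u₂ - 1) / 2) f) = zeroO ((u₂ - u₁ - 1) / 2) (T f) := by
    intro f hf
    have h3 := hgen 3 hf
    simp only [weightO, genO, Matrix.cons_val, one_smul, Module.End.mul_apply,
      LinearMap.smul_apply, map_smul] at h3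
    exact smul_right_injective _ two_ne_zero h3
  have hzeroO : ∀ l : ℂ, zeroO l = funEuler (fun x => x - l) := by
    intro l
    ext x : 2
    simp only [LinearMap.comp_apply, Finsupp.lsingle_apply, zeroO_single, funEuler_single]
  -- The image of `z ^ (lam + n)` is an eigenvector of `S` in spin `-1 - l`, with the eigenvalue
  -- that belongs to `z ^ (lam + n - a)`. As `x ↦ x - l'` is injective, that eigenspace is spanned
  -- by one monomial.
  have hU : ∀ n : ℤ, T (Finsupp.single (lam + n) 1) =
      Finsupp.single (lam + n - a) (T (Finsupp.single (lam + n) 1) (lam + n - a)) := by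
    intro n
    have h := hzero _ (single_mem_powerModule lam n 1)
    rw [zeroO_single, hzeroO] at h
    rw [show Finsupp.single (lam + (n : ℂ)) (1 * (lam + n - (u₁ - u₂ - 1) / 2)) =
      (lam + n - a - (u₂ - u₁ - 1) / 2) • Finsupp.single (lam + (n : ℂ)) (1 : ℂ) by
        rw [Finsupp.smul_single, smul_eq_mul]; congr 1; rw [ha_def]; ring, map_smul] at h
    refine eq_single_of_funEuler_eigen (Φ := fun x => x - (u₂ - u₁ - 1) / 2) h.symm ?_
    intro x _ hx
    linear_combination hx
  have hne : ∀ n : ℤ, lam + (n : ℂ) ≠ 0 := fun n h => hlam (-n) (by push_cast; linear_combination h)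
  have hne' : ∀ n : ℤ, lam + (n : ℂ) - a ≠ 0 := fun n h =>
    ha (-n) (by push_cast; linear_combination h)
  refine eq_const_smul_of_lowering (N := id) (interO_single a)
    (fun n => mul_Gamma_div_Gamma _ (hne n)) hne hne' ?_ minusO_single hminus hU
  refine div_ne_zero (Complex.Gamma_ne_zero fun m h => hlam (-m - 1) ?_)
    (Complex.Gamma_ne_zero fun m h => ha (-m - 1) ?_)
  · push_cast
    linear_combination h
  · push_cast
    linear_combination h

/-! ### The q-deformed operator -/

theorem qpow_add (h x y : ℂ) : qpow h (x + y) = qpow h x * qpow h y := by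
  rw [qpow, mul_add, Complex.exp_add]; rfl

theorem qpow_ne_zero (h x : ℂ) : qpow h x ≠ 0 := Complex.exp_ne_zero _

@[simp] theorem qpow_zero (h : ℂ) : qpow h 0 = 1 := by simp [qpow]

theorem qpow_neg (h x : ℂ) : qpow h (-x) = (qpow h x)⁻¹ := by
  rw [qpow, mul_neg, Complex.exp_neg]; rfl

theorem norm_qpow_real (h : ℂ) (x : ℝ) : ‖qpow h x‖ = Real.exp (h.re * x) := by
  rw [qpow, Complex.norm_exp]
  simp

/-- The modulus `|q ^ x| = exp (x Re h)` differs from `1`. This excludes the values `1` and `-1`,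
which is how the denominators `q ± 1` and the coincidences of eigenvalues are controlled. -/
theorem qpow_real_ne_one {h : ℂ} (hh : h.re < 0) {x : ℝ} (hx : x ≠ 0) {y : ℂ} (hy : ‖y‖ = 1) :
    qpow h x ≠ y := by
  intro e
  have h1 := norm_qpow_real h x
  rw [e, hy, eq_comm, Real.exp_eq_one_iff] at h1
  exact (mul_ne_zero hh.ne hx) h1

theorem summable_qPoch {h : ℂ} (hh : h.re < 0) (y : ℂ) :
    Summable fun k : ℕ => ‖-(y * qpow h (2 * (k : ℂ)))‖ := by
  have : ∀ k : ℕ, ‖-(y * qpow h (2 * (k : ℂ)))‖ = ‖y‖ * Real.exp (h.re * 2) ^ k := by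
    intro k
    rw [norm_neg, norm_mul, show (2 * (k : ℂ)) = ((2 * k : ℝ) : ℂ) by push_cast; ring,
      norm_qpow_real, ← Real.exp_nat_mul]
    congr 2
    ring
  simp_rw [this]
  refine (summable_geometric_of_lt_one (Real.exp_pos _).le ?_).mul_left _
  rw [Real.exp_lt_one_iff]
  linarith

theorem multipliable_qPoch {h : ℂ} (hh : h.re < 0) (y : ℂ) :
    Multipliable fun k : ℕ => (1 - y * qpow h (2 * (k : ℂ))) := by
  simpa only [sub_eq_add_neg] using multipliable_one_add_of_summable (summable_qPoch hh y)

theorem qPoch_eq_mul {h : ℂ} (hh : h.re < 0) (x : ℂ) :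
    qPoch h (qpow h (2 * x)) = (1 - qpow h (2 * x)) * qPoch h (qpow h (2 * x + 2)) := by
  have hm : Multipliable fun k : ℕ =>
      (1 - qpow h (2 * x) * qpow h (2 * ((k + 1 : ℕ) : ℂ))) := by
    refine (multipliable_qPoch hh (qpow h (2 * x + 2))).congr fun k => ?_
    rw [← qpow_add, ← qpow_add]
    push_cast
    ring_nf
  rw [qPoch, tprod_eq_zero_mul' (f := fun k : ℕ => 1 - qpow h (2 * x) * qpow h (2 * (k : ℂ))) hm,
    qPoch, Nat.cast_zero, mul_zero, qpow_zero, mul_one]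
  congr 1
  refine tprod_congr fun k => ?_
  rw [← qpow_add, ← qpow_add]
  push_cast
  ring_nf

theorem qPoch_ne_zero {h : ℂ} (hh : h.re < 0) {x : ℂ} (hx : ∀ k : ℕ, qpow h (2 * (x + k)) ≠ 1) :
    qPoch h (qpow h (2 * x)) ≠ 0 := by
  rw [qPoch]
  simp_rw [sub_eq_add_neg]
  refine tprod_one_add_ne_zero_of_summable (fun k e => hx k ?_) (summable_qPoch hh _)
  rw [mul_add, qpow_add]
  linear_combination -e

theorem minusQ_single (h x c : ℂ) :
    minusQ h (Finsupp.single x c) = Finsupp.single (x - 1) (c * -qnum h x) := by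
  rw [minusQ, LinearMap.neg_apply, Module.End.mul_apply, funEuler_single, zPow_single,
    ← Finsupp.single_neg, ← sub_eq_add_neg, mul_neg]

theorem plusQ_single (h l x c : ℂ) :
    plusQ h l (Finsupp.single x c) = Finsupp.single (x + 1) (c * qnum h (x - 2 * l)) := by
  rw [plusQ, Module.End.mul_apply, funEuler_single, zPow_single]

/-- The coefficient of `W(a)` on `z ^ x`. -/
noncomputable def interQCoeff (h a x : ℂ) : ℂ :=
  qpow h (a ^ 2 / 2) *
    (qPoch h (qpow h (2 * x + 2 - 2 * a)) / qPoch h (qpow h (2 * x + 2))) * qpow h (-(a * x))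

theorem interQ_single (h a x c : ℂ) :
    interQ h a (Finsupp.single x c) = Finsupp.single (x - a) (c * interQCoeff h a x) := by
  rw [interQ, LinearMap.smul_apply, Module.End.mul_apply, Module.End.mul_apply, funEuler_single,
    funEuler_single, zPow_single, Finsupp.smul_single, smul_eq_mul, interQCoeff, sub_eq_add_neg x a]
  congr 1
  ring

/-- Passing from `x` to `x - 1` splits off the first factor of each infinite product, which leaves
`(1 - q^(2(x-a))) / (1 - q^(2x))`. This equals `[x - a]_q / [x]_q` up to `q^(-a)`, and the factor
`q^(-a z∂)` compensates for that power. -/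
theorem qnum_mul_interQCoeff {h : ℂ} (hh : h.re < 0) (a : ℂ) {x : ℂ} (hx : qpow h (2 * x) ≠ 1) :
    qnum h x * interQCoeff h a (x - 1) = qnum h (x - a) * interQCoeff h a x := by
  have hX := qpow_ne_zero h x
  have hA := qpow_ne_zero h a
  have e1 : qpow h (2 * x) = qpow h x ^ 2 := by rw [two_mul, qpow_add, sq]
  have e2 : qpow h (x - a) = qpow h x / qpow h a := by
    rw [sub_eq_add_neg, qpow_add, qpow_neg, div_eq_mul_inv]
  have e3 : qpow h (2 * (x - a)) = (qpow h x / qpow h a) ^ 2 := by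
    rw [two_mul, qpow_add, e2, sq]
  have e4 : qpow h (-(a * (x - 1))) = qpow h (-(a * x)) * qpow h a := by
    rw [← qpow_add]; ring_nf
  have h1 : 1 - qpow h x ^ 2 ≠ 0 := by
    rw [← e1]
    exact sub_ne_zero.mpr hx.symm
  simp only [interQCoeff, qnum]
  rw [show 2 * (x - 1) + 2 - 2 * a = 2 * (x - a) by ring,
    show 2 * (x - 1) + 2 = 2 * x by ring, qPoch_eq_mul hh x, qPoch_eq_mul hh (x - a), e4,
    show 2 * (x - a) + 2 = 2 * x + 2 - 2 * a by ring, qpow_neg h (x - a), qpow_neg h x, e1, e2, e3,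
    mul_div_mul_comm]
  generalize qPoch h (qpow h (2 * x + 2 - 2 * a)) / qPoch h (qpow h (2 * x + 2)) = R
  generalize qpow h 1 - qpow h (-1) = d
  field_simp
  ring

theorem interQ_gen {h lam : ℂ} (hh : h.re < 0) (hlam : ∀ n : ℤ, qpow h (2 * (lam + n)) ≠ 1)
    {l l' : ℂ} (hl' : l' = -1 - l) (c : Fin 4) :
    ∀ f ∈ powerModule lam,
      (interQ h (2 * l + 1) * genQ h l c) f = (genQ h l' c * interQ h (2 * l + 1)) f := by
  have hT := interQ_single h (2 * l + 1)
  have hρ := fun n : ℤ => qnum_mul_interQCoeff hh (2 * l + 1) (hlam n)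
  have hM := intertwine_lowering hT hρ (minusQ_single h)
  have hP := intertwine_raising hT hρ rfl hl' (plusQ_single h l) (plusQ_single h l')
  have hD := fun Φ : ℂ → ℂ => intertwine_diagonal (lam := lam) (Φ := Φ) hT rfl hl'
    (D := funEuler fun x => Φ (x - l)) (D' := funEuler fun x => Φ (x - l'))
    (fun x c => funEuler_single _ x c) (fun x c => funEuler_single _ x c)
  intro f hf
  have hM := hM f hf
  have hP := hP f hf
  simp only [Module.End.mul_apply] at hM hP
  fin_cases c
  · exact hD (fun y => (qpow h y + qpow h (-y)) / (qpow h (1 / 2) + qpow h (-(1 / 2)))) f hf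
  · simp [genQ, hM, hP]
  · simp [genQ, hM, hP]
  · exact hD (fun y => (qpow h y - qpow h (-y)) / (qpow h (1 / 2) - qpow h (-(1 / 2)))) f hf

theorem interQ_laxRelOn {h lam : ℂ} (hh : h.re < 0) (hlam : ∀ n : ℤ, qpow h (2 * (lam + n)) ≠ 1)
    (u₁ u₂ : ℂ) :
    LaxRelOn (powerModule lam) (interQ h (u₁ - u₂)) (laxQ h u₁ u₂) (laxQ h u₂ u₁) := by
  rw [laxQ, laxQ, add_comm u₂ u₁]
  refine laxRelOn_of_gen fun c => ?_
  have h := interQ_gen hh hlam (l := (u₁ - u₂ - 1) / 2) (l' := (u₂ - u₁ - 1) / 2) (by ring) c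
  rwa [show 2 * ((u₁ - u₂ - 1) / 2) + 1 = u₁ - u₂ by ring] at h

theorem qnum_ne_zero {h : ℂ} (hh : h.re < 0) {x : ℂ} (hx : qpow h (2 * x) ≠ 1) :
    qnum h x ≠ 0 := by
  have aux : ∀ y, qpow h (2 * y) ≠ 1 → qpow h y - qpow h (-y) ≠ 0 := by
    intro y hy e
    apply hy
    rw [two_mul, qpow_add]
    nth_rewrite 2 [sub_eq_zero.mp e]
    rw [qpow_neg, mul_inv_cancel₀ (qpow_ne_zero h y)]
  refine div_ne_zero (aux x hx) (aux 1 ?_)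
  have := qpow_real_ne_one hh (x := 2) two_ne_zero (y := 1) norm_one
  simpa using this

/-- The function `q ^ x` does not separate exponents that differ by a multiple of `2πi/h`, so the
eigenvalue argument needs the prescribed target `powerModule (lam - a)`, where exponents differ by
integers only. -/
theorem interQ_unique {h lam : ℂ} (hh : h.re < 0) (hlam : ∀ n : ℤ, qpow h (2 * (lam + n)) ≠ 1)
    {u₁ u₂ : ℂ} (ha : ∀ n : ℤ, qpow h (2 * (lam - (u₁ - u₂) + n)) ≠ 1)
    (hw : ∀ c, weightQ h ((u₁ + u₂ + 1) / 2) c ≠ 0) {T : Module.End ℂ PowerSums}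
    (hTV : ∀ f ∈ powerModule lam, T f ∈ powerModule (lam - (u₁ - u₂)))
    (hT : LaxRelOn (powerModule lam) T (laxQ h u₁ u₂) (laxQ h u₂ u₁)) :
    ∃ c : ℂ, ∀ f ∈ powerModule lam, T f = c • interQ h (u₁ - u₂) f := by
  rw [laxQ, laxQ, add_comm u₂ u₁] at hT
  have hgen : ∀ c, ∀ f ∈ powerModule lam, T (genQ h ((u₁ - u₂ - 1) / 2) c f) =
      genQ h ((u₂ - u₁ - 1) / 2) c (T f) := fun c f hf =>
    smul_right_injective _ (hw c) (smul_gen_of_laxRelOn hT c hf)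
  set a := u₁ - u₂ with ha_def
  have hl : (u₂ - u₁ - 1) / 2 = -1 - (a - 1) / 2 := by rw [ha_def]; ring
  rw [hl] at hgen
  have hminus : ∀ f ∈ powerModule lam, T (minusQ h f) = minusQ h (T f) := by
    intro f hf
    have h1 := hgen 1 f hf
    have h2 := hgen 2 f hf
    simp only [genQ, Matrix.cons_val_one, Matrix.cons_val,
      LinearMap.add_apply, LinearMap.sub_apply, LinearMap.smul_apply, map_add, map_sub,
      map_smul] at h1 h2
    have h2 := smul_right_injective _ (neg_ne_zero.mpr Complex.I_ne_zero) h2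
    have h3 : (2 : ℂ) • T (minusQ h f) = (2 : ℂ) • minusQ h (T f) := by
      linear_combination (norm := module) h1 - h2
    exact smul_right_injective _ two_ne_zero h3
  have hne1 : qpow h (1 / 2) + qpow h (-(1 / 2)) ≠ 0 := by
    intro e
    refine qpow_real_ne_one hh (x := 1) one_ne_zero (y := -1) (by simp) ?_
    have h2 : qpow h (1 / 2) * qpow h (1 / 2) = qpow h ((1 : ℝ) : ℂ) := by
      rw [← qpow_add]; norm_num
    have h3 : qpow h (1 / 2) * qpow h (-(1 / 2)) = 1 := by
      rw [← qpow_add]; norm_num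
    linear_combination -h2 + qpow h (1 / 2) * e - h3
  have hne2 : qpow h (1 / 2) - qpow h (-(1 / 2)) ≠ 0 := by
    intro e
    refine qpow_real_ne_one hh (x := 1) one_ne_zero (y := 1) (by simp) ?_
    have h2 : qpow h (1 / 2) * qpow h (1 / 2) = qpow h ((1 : ℝ) : ℂ) := by
      rw [← qpow_add]; norm_num
    have h3 : qpow h (1 / 2) * qpow h (-(1 / 2)) = 1 := by
      rw [← qpow_add]; norm_num
    linear_combination -h2 + qpow h (1 / 2) * e + h3
  -- A single combination of `𝐒⁰` and `𝐒³` is twice `q ^ S`, whose eigenvalues are easier to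
  -- separate than those of either generator.
  have hdiag : ∀ l : ℂ, (qpow h (1 / 2) + qpow h (-(1 / 2))) • genQ h l 0 +
      (qpow h (1 / 2) - qpow h (-(1 / 2))) • genQ h l 3 =
      (2 : ℂ) • funEuler (fun x => qpow h (x - l)) := by
    intro l
    ext x : 2
    simp only [LinearMap.comp_apply, Finsupp.lsingle_apply, genQ, Matrix.cons_val_zero,
      Matrix.cons_val, LinearMap.add_apply, LinearMap.smul_apply, funEuler_single,
      Finsupp.smul_single, smul_eq_mul, ← Finsupp.single_add]
    congr 1
    field_simp
    ring
  have hEuler : ∀ f ∈ powerModule lam, T (funEuler (fun x => qpow h (x - (a - 1) / 2)) f) =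
      funEuler (fun x => qpow h (x - (-1 - (a - 1) / 2))) (T f) := by
    intro f hf
    refine smul_right_injective _ (two_ne_zero (α := ℂ)) ?_
    change (2 : ℂ) • T _ = (2 : ℂ) • _
    rw [← map_smul, ← LinearMap.smul_apply, ← LinearMap.smul_apply, ← hdiag, ← hdiag]
    simp only [LinearMap.add_apply, LinearMap.smul_apply, map_add, map_smul, hgen _ f hf]
  have hU : ∀ n : ℤ, T (Finsupp.single (lam + n) 1) =
      Finsupp.single (lam + n - a) (T (Finsupp.single (lam + n) 1) (lam + n - a)) := by
    intro n
    have hmem := single_mem_powerModule lam n 1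
    have h1 := hEuler _ hmem
    rw [funEuler_single, show lam + (n : ℂ) - (a - 1) / 2 = lam + n - a - (-1 - (a - 1) / 2) by ring,
      one_mul, ← mul_one (qpow h _), ← smul_eq_mul, ← Finsupp.smul_single, map_smul] at h1
    refine eq_single_of_funEuler_eigen (Φ := fun x => qpow h (x - (-1 - (a - 1) / 2))) h1.symm ?_
    -- Exponents in the support lie in `lam - a + ℤ`. Equal eigenvalues at `m ≠ n` would give `q ^
    -- (m - n) = 1`, against `|q| < 1`.
    intro x hx he
    obtain ⟨m, rfl⟩ := (Finsupp.mem_supported ℂ _).mp (hTV _ hmem) hx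
    simp only at he ⊢
    by_contra hne
    have hmn : ((m - n : ℤ) : ℝ) ≠ 0 := by
      rw [Int.cast_ne_zero, sub_ne_zero]
      rintro rfl
      exact hne (by ring)
    refine qpow_real_ne_one hh hmn (y := 1) norm_one ?_
    apply mul_right_cancel₀ (qpow_ne_zero h (lam + n - a - (-1 - (a - 1) / 2)))
    rw [one_mul]
    refine Eq.trans ?_ he
    rw [← qpow_add]
    congr 1
    push_cast
    ring
  have hlam' : ∀ n : ℤ, qpow h (2 * (lam + n - a)) ≠ 1 := fun n => by
    rw [show lam + (n : ℂ) - a = lam - a + n by ring]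
    exact ha n
  refine eq_const_smul_of_lowering (interQ_single h a)
    (fun n => qnum_mul_interQCoeff hh a (hlam n)) (fun n => qnum_ne_zero hh (hlam n))
    (fun n => qnum_ne_zero hh (hlam' n)) ?_ (minusQ_single h) hminus hU
  refine mul_ne_zero (mul_ne_zero (qpow_ne_zero _ _) (div_ne_zero ?_ ?_)) (qpow_ne_zero _ _)
  · rw [show 2 * lam + 2 - 2 * a = 2 * (lam - a + 1) by ring]
    refine qPoch_ne_zero hh fun k => ?_
    have := ha (k + 1)
    push_cast at this
    rwa [add_assoc, add_comm (1 : ℂ)]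
  · rw [show 2 * lam + 2 = 2 * (lam + 1) by ring]
    refine qPoch_ne_zero hh fun k => ?_
    have := hlam (k + 1)
    push_cast at this
    rwa [add_assoc, add_comm (1 : ℂ)]

/-! ### Theta functions with characteristics -/

/-- The summand of `thetaChar`. -/
noncomputable def thetaTerm (a b τ z : ℂ) (n : ℤ) : ℂ :=
  Complex.exp (Real.pi * Complex.I * ((n : ℂ) + a) ^ 2 * τ +
    2 * Real.pi * Complex.I * ((n : ℂ) + a) * (z + b))

theorem thetaChar_eq_tsum (a b τ z : ℂ) : thetaChar a b τ z = ∑' n, thetaTerm a b τ z n := rfl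

theorem thetaTerm_eq (a b τ z : ℂ) (n : ℤ) :
    thetaTerm a b τ z n = Complex.exp (Real.pi * Complex.I * a ^ 2 * τ +
      2 * Real.pi * Complex.I * a * (z + b)) * jacobiTheta₂_term n (z + b + a * τ) τ := by
  rw [thetaTerm, jacobiTheta₂_term, ← Complex.exp_add]
  ring_nf

theorem thetaChar_eq (a b τ z : ℂ) :
    thetaChar a b τ z = Complex.exp (Real.pi * Complex.I * a ^ 2 * τ +
      2 * Real.pi * Complex.I * a * (z + b)) * jacobiTheta₂ (z + b + a * τ) τ := by
  rw [thetaChar_eq_tsum, funext (thetaTerm_eq a b τ z), tsum_mul_left]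
  rfl

variable {τ : ℂ}

theorem summable_thetaTerm (hτ : 0 < τ.im) (a b z : ℂ) : Summable (thetaTerm a b τ z) := by
  rw [funext (thetaTerm_eq a b τ z)]
  exact ((summable_jacobiTheta₂_term_iff _ τ).mpr hτ).mul_left _

theorem differentiable_thetaChar (hτ : 0 < τ.im) (a b : ℂ) : Differentiable ℂ (thetaChar a b τ) := by
  rw [funext (thetaChar_eq a b τ)]
  intro z
  refine DifferentiableAt.mul (by fun_prop) ?_
  exact DifferentiableAt.comp z (g := fun x => jacobiTheta₂ x τ)
    (differentiableAt_jacobiTheta₂_fst (z + b + a * τ) hτ) (by fun_prop)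

theorem thetaChar_add_one_left (a b τ z : ℂ) : thetaChar (a + 1) b τ z = thetaChar a b τ z := by
  rw [thetaChar_eq_tsum, thetaChar_eq_tsum, ← (Equiv.addRight (1 : ℤ)).tsum_eq (thetaTerm a b τ z)]
  refine tsum_congr fun n => ?_
  simp only [thetaTerm, Equiv.coe_addRight]
  push_cast
  ring_nf

theorem thetaChar_add_one_right (a b τ z : ℂ) :
    thetaChar a (b + 1) τ z = Complex.exp (2 * Real.pi * Complex.I * a) * thetaChar a b τ z := by
  rw [thetaChar_eq_tsum, thetaChar_eq_tsum, ← tsum_mul_left]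
  refine tsum_congr fun n => ?_
  simp only [thetaTerm]
  rw [← Complex.exp_add, Complex.exp_eq_exp_iff_exists_int]
  exact ⟨n, by ring⟩

theorem thetaChar_neg (a b τ z : ℂ) : thetaChar a b τ (-z) = thetaChar (-a) (-b) τ z := by
  rw [thetaChar_eq_tsum, thetaChar_eq_tsum, ← (Equiv.neg ℤ).tsum_eq (thetaTerm (-a) (-b) τ z)]
  refine tsum_congr fun n => ?_
  simp only [thetaTerm, Equiv.neg_apply]
  push_cast
  ring_nf

theorem thetaChar_add_one (a b τ z : ℂ) : thetaChar a b τ (z + 1) =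
    Complex.exp (2 * Real.pi * Complex.I * a) * thetaChar a b τ z := by
  rw [← thetaChar_add_one_right, thetaChar_eq_tsum, thetaChar_eq_tsum]
  refine tsum_congr fun n => ?_
  simp only [thetaTerm]
  ring_nf

theorem thetaChar_add_tau (a b τ z : ℂ) : thetaChar a b τ (z + τ) =
    Complex.exp (-(Real.pi * Complex.I * τ) - 2 * Real.pi * Complex.I * (z + b)) *
      thetaChar a b τ z := by
  rw [← thetaChar_add_one_left a b τ z, thetaChar_eq_tsum, thetaChar_eq_tsum, ← tsum_mul_left]
  refine tsum_congr fun n => ?_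
  simp only [thetaTerm]
  rw [← Complex.exp_add]
  ring_nf

/-- The pairs of integers, split by the parity of their sum. -/
def parityEquiv : (ℤ × ℤ) ⊕ (ℤ × ℤ) ≃ ℤ × ℤ where
  toFun := Sum.elim (fun p => (p.1 + p.2, p.1 - p.2)) (fun p => (p.1 + p.2 + 1, p.1 - p.2))
  invFun := fun p => if (p.1 + p.2) % 2 = 0 then .inl ((p.1 + p.2) / 2, (p.1 - p.2) / 2)
    else .inr ((p.1 + p.2 - 1) / 2, (p.1 - p.2 - 1) / 2)
  left_inv := by
    rintro (⟨k, l⟩ | ⟨k, l⟩)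
    · change (if (k + l + (k - l)) % 2 = 0 then Sum.inl _ else Sum.inr _) = _
      rw [if_pos (by omega)]
      exact congrArg Sum.inl (Prod.ext (by simp; omega) (by simp; omega))
    · change (if (k + l + 1 + (k - l)) % 2 = 0 then Sum.inl _ else Sum.inr _) = _
      rw [if_neg (by omega)]
      exact congrArg Sum.inr (Prod.ext (by simp; omega) (by simp; omega))
  right_inv := by
    rintro ⟨n, m⟩
    simp only
    split_ifs with h <;> simp only [Sum.elim_inl, Sum.elim_inr] <;> congr 1 <;> omega

/-- The product of two theta functions of period `τ` in terms of those of period `2τ`. -/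
theorem thetaChar_mul (hτ : 0 < τ.im) (a b a' b' x y : ℂ) :
    thetaChar a b τ x * thetaChar a' b' τ y =
      thetaChar ((a + a') / 2) (b + b') (2 * τ) (x + y) *
          thetaChar ((a - a') / 2) (b - b') (2 * τ) (x - y) +
        thetaChar ((a + a' + 1) / 2) (b + b') (2 * τ) (x + y) *
          thetaChar ((a - a' + 1) / 2) (b - b') (2 * τ) (x - y) := by
  have hτ2 : 0 < (2 * τ).im := by simpa using hτ
  have hmul : ∀ {σ σ' : ℂ}, 0 < σ.im → 0 < σ'.im → ∀ a b a' b' x y : ℂ,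
      HasSum (fun p : ℤ × ℤ => thetaTerm a b σ x p.1 * thetaTerm a' b' σ' y p.2)
        (thetaChar a b σ x * thetaChar a' b' σ' y) := by
    intro σ σ' h h' a b a' b' x y
    have h1 := (summable_thetaTerm h a b x).norm
    have h2 := (summable_thetaTerm h' a' b' y).norm
    rw [thetaChar_eq_tsum, thetaChar_eq_tsum, tsum_mul_tsum_of_summable_norm h1 h2]
    exact (summable_mul_of_summable_norm h1 h2).hasSum
  have hL := parityEquiv.hasSum_iff.mpr (hmul hτ hτ a b a' b' x y)
  refine hL.unique (HasSum.sum ?_ ?_)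
  -- For `(n, m) = (k + l, k - l)` the quadratic exponents separate: `(n + a)² + (m + a')² = 2(k +
  -- (a + a')/2)² + 2(l + (a - a')/2)²`. In the odd class both new characteristics grow by `1/2`.
  · convert! hmul hτ2 hτ2 ((a + a') / 2) (b + b') ((a - a') / 2) (b - b') (x + y) (x - y) using 1
    ext ⟨k, l⟩
    simp only [Function.comp_apply, parityEquiv, Equiv.coe_fn_mk, Sum.elim_inl, thetaTerm,
      ← Complex.exp_add]
    push_cast
    ring_nf
  · convert! hmul hτ2 hτ2 ((a + a' + 1) / 2) (b + b') ((a - a' + 1) / 2) (b - b') (x + y) (x - y)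
      using 1
    ext ⟨k, l⟩
    simp only [Function.comp_apply, parityEquiv, Equiv.coe_fn_mk, Sum.elim_inr, thetaTerm,
      ← Complex.exp_add]
    push_cast
    ring_nf

/-! ### Theta functions of degree two -/

/-- `θ₃(2s|2τ)` and `θ₂(2s|2τ)`. -/
noncomputable def theta2 (τ : ℂ) (i : Fin 2) (s : ℂ) : ℂ :=
  ![thetaChar 0 0 (2 * τ) (2 * s), thetaChar (1 / 2) 0 (2 * τ) (2 * s)] i

theorem exp_two_pi_half : Complex.exp (2 * Real.pi * Complex.I * (1 / 2)) = -1 := by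
  rw [show 2 * (Real.pi : ℂ) * Complex.I * (1 / 2) = Real.pi * Complex.I by ring,
    Complex.exp_pi_mul_I]

theorem theta2_neg (τ : ℂ) (i : Fin 2) (s : ℂ) : theta2 τ i (-s) = theta2 τ i s := by
  fin_cases i
  · simp [theta2, mul_neg, thetaChar_neg]
  · simp only [theta2, Fin.mk_one, Matrix.cons_val_one, Matrix.cons_val_fin_one, mul_neg,
      thetaChar_neg, neg_zero]
    rw [← thetaChar_add_one_left, show -(1 / 2 : ℂ) + 1 = 1 / 2 by norm_num]

theorem thetaChar_one_left (b τ z : ℂ) : thetaChar 1 b τ z = thetaChar 0 b τ z := by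
  rw [← thetaChar_add_one_left 0, zero_add]

theorem thetaChar_zero_one (τ z : ℂ) : thetaChar 0 1 τ z = thetaChar 0 0 τ z := by
  have := thetaChar_add_one_right 0 0 τ z
  simpa using this

theorem thetaChar_half_one (τ z : ℂ) : thetaChar (1 / 2) 1 τ z = -thetaChar (1 / 2) 0 τ z := by
  have := thetaChar_add_one_right (1 / 2) 0 τ z
  rw [exp_two_pi_half, zero_add] at this
  rw [this]
  ring

/-- With `v(s) = (theta2 τ 0 s, theta2 τ 1 s)`, each product `θ_c(p + r) θ_c(p - r)` is a bilinear
form in `v(p)` and `v(r)`. For `c = 0` it is the determinant; the other three indices give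
independent symmetric forms. -/
theorem theta_zero_mul (hτ : 0 < τ.im) (p r : ℂ) : theta τ 0 (p + r) * theta τ 0 (p - r) =
    theta2 τ 0 p * theta2 τ 1 r - theta2 τ 1 p * theta2 τ 0 r := by
  have h := thetaChar_mul hτ (1 / 2) (1 / 2) (1 / 2) (1 / 2) (p + r) (p - r)
  rw [show p + r + (p - r) = 2 * p by ring, show p + r - (p - r) = 2 * r by ring, sub_self,
    add_halves, zero_div, zero_add, one_add_one_eq_two, div_self two_ne_zero, thetaChar_one_left,
    thetaChar_zero_one, thetaChar_half_one] at h
  simp only [theta, theta2, Matrix.cons_val_zero, Matrix.cons_val_one, Matrix.cons_val_fin_one]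
  linear_combination h

theorem theta_one_mul (hτ : 0 < τ.im) (p r : ℂ) : theta τ 1 (p + r) * theta τ 1 (p - r) =
    theta2 τ 1 p * theta2 τ 0 r + theta2 τ 0 p * theta2 τ 1 r := by
  have h := thetaChar_mul hτ (1 / 2) 0 (1 / 2) 0 (p + r) (p - r)
  rw [show p + r + (p - r) = 2 * p by ring, show p + r - (p - r) = 2 * r by ring, sub_self,
    add_halves, zero_div, zero_add, one_add_one_eq_two, div_self two_ne_zero, thetaChar_one_left,
    sub_zero, zero_add] at h
  simp only [theta, theta2, Matrix.cons_val_zero, Matrix.cons_val_one, Matrix.cons_val_fin_one]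
  linear_combination h

theorem theta_two_mul (hτ : 0 < τ.im) (p r : ℂ) : theta τ 2 (p + r) * theta τ 2 (p - r) =
    theta2 τ 0 p * theta2 τ 0 r + theta2 τ 1 p * theta2 τ 1 r := by
  have h := thetaChar_mul hτ 0 0 0 0 (p + r) (p - r)
  rw [show p + r + (p - r) = 2 * p by ring, show p + r - (p - r) = 2 * r by ring, sub_self,
    add_zero, zero_div, zero_add] at h
  simp only [theta, theta2, Matrix.cons_val_zero, Matrix.cons_val_one, Matrix.cons_val_fin_one,
    Matrix.cons_val]
  linear_combination h

theorem theta_three_mul (hτ : 0 < τ.im) (p r : ℂ) : theta τ 3 (p + r) * theta τ 3 (p - r) =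
    theta2 τ 0 p * theta2 τ 0 r - theta2 τ 1 p * theta2 τ 1 r := by
  have h := thetaChar_mul hτ 0 (1 / 2) 0 (1 / 2) (p + r) (p - r)
  rw [show p + r + (p - r) = 2 * p by ring, show p + r - (p - r) = 2 * r by ring, sub_self,
    sub_self, add_halves, add_zero, zero_div, zero_add, thetaChar_zero_one, thetaChar_half_one] at h
  simp only [theta, theta2, Matrix.cons_val_zero, Matrix.cons_val_one, Matrix.cons_val_fin_one,
    Matrix.cons_val]
  linear_combination h

theorem theta_zero_neg (τ z : ℂ) : theta τ 0 (-z) = -theta τ 0 z := by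
  have h := thetaChar_add_one_right (1 / 2) (-(1 / 2)) τ z
  rw [exp_two_pi_half, show (-(1 / 2) : ℂ) + 1 = 1 / 2 by norm_num] at h
  simp only [theta, Matrix.cons_val_zero]
  rw [thetaChar_neg, ← thetaChar_add_one_left, show (-(1 / 2) : ℂ) + 1 = 1 / 2 by norm_num, h]
  ring

theorem theta_zero_zero (τ : ℂ) : theta τ 0 0 = 0 := by
  have h := theta_zero_neg τ 0
  rw [neg_zero] at h
  exact self_eq_neg.mp h

theorem differentiable_theta (hτ : 0 < τ.im) (c : Fin 4) : Differentiable ℂ (theta τ c) := by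
  fin_cases c <;> exact differentiable_thetaChar hτ _ _

theorem theta_eq_thetaChar (τ : ℂ) (c : Fin 4) : ∃ a b, theta τ c = thetaChar a b τ := by
  fin_cases c <;> exact ⟨_, _, rfl⟩

/-- All four theta functions are translates of one Jacobi function, up to exponential factors. -/
theorem exists_theta_ne_zero {c : Fin 4} {w : ℂ} (h : theta τ c w ≠ 0) (d : Fin 4) :
    ∃ z, theta τ d z ≠ 0 := by
  obtain ⟨a, b, e⟩ := theta_eq_thetaChar τ c
  obtain ⟨a', b', e'⟩ := theta_eq_thetaChar τ d
  rw [e, thetaChar_eq] at h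
  refine ⟨w + b + a * τ - b' - a' * τ, ?_⟩
  rw [e', thetaChar_eq]
  refine mul_ne_zero (Complex.exp_ne_zero _) ?_
  convert right_ne_zero_of_mul h using 2
  ring

/-- If `s₁ + s₂ + s₃ + s₄ = 0`, the vectors `θ_c(2sᵢ)`, `c = 0, …, 3`, are linearly dependent. -/
theorem sum_theta_eq_zero (hτ : 0 < τ.im) {s₁ s₂ s₃ s₄ : ℂ} (hs : s₁ + s₂ + s₃ + s₄ = 0) {c : Fin 4}
    (hc : theta τ c (s₁ + s₃) ≠ 0) :
    theta τ 0 (s₂ - s₃) * theta τ 0 (s₂ - s₄) * theta τ 0 (s₃ - s₄) * theta τ c (2 * s₁)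
      - theta τ 0 (s₁ - s₃) * theta τ 0 (s₁ - s₄) * theta τ 0 (s₃ - s₄) * theta τ c (2 * s₂)
      + theta τ 0 (s₁ - s₂) * theta τ 0 (s₁ - s₄) * theta τ 0 (s₂ - s₄) * theta τ c (2 * s₃)
      - theta τ 0 (s₁ - s₂) * theta τ 0 (s₁ - s₃) * theta τ 0 (s₂ - s₃) * theta τ c (2 * s₄) = 0 := by
  -- The parameters are chosen so that `2m = s₁ + s₃ = -(s₂ + s₄)`. Multiplying by `θ_c(2m)` then
  -- turns each `θ_c(2sᵢ)` into the `c`-th bilinear form of `v(sᵢ + m)` and `v(sᵢ - m)`, where `v =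
  -- (theta2 τ 0, theta2 τ 1)`.
  obtain ⟨m, hm⟩ : ∃ m, m = (s₁ + s₃) / 2 := ⟨_, rfl⟩
  obtain ⟨d, hd⟩ : ∃ d, d = (s₁ - s₃) / 2 := ⟨_, rfl⟩
  obtain ⟨e, he⟩ : ∃ e, e = (s₂ - s₄) / 2 := ⟨_, rfl⟩
  obtain rfl : s₁ = d + m := by rw [hd, hm]; ring
  obtain rfl : s₃ = m - d := by linear_combination -2 * hm
  obtain rfl : s₂ = e - m := by linear_combination -he + hs / 2
  obtain rfl : s₄ = -e - m := by linear_combination hs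
  rw [show d + m + (m - d) = 2 * m by ring] at hc
  have w1 := theta_zero_mul hτ e (d - 2 * m)
  have w2 := theta_zero_mul hτ (e + 2 * m) d
  have w3 := theta_zero_mul hτ (d + 2 * m) e
  have w4 := theta_zero_mul hτ d (e - 2 * m)
  have w5 := theta_zero_mul hτ (d - 2 * m) (d + 2 * m)
  have w6 := theta_zero_mul hτ (e - 2 * m) (e + 2 * m)
  rw [show d - 2 * m + (d + 2 * m) = 2 * d by ring,
    show d - 2 * m - (d + 2 * m) = -(4 * m) by ring, theta_zero_neg] at w5
  rw [show e - 2 * m + (e + 2 * m) = 2 * e by ring,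
    show e - 2 * m - (e + 2 * m) = -(4 * m) by ring, theta_zero_neg] at w6
  rw [show e - m - (m - d) = e + (d - 2 * m) by ring, show e - m - (-e - m) = 2 * e by ring,
    show m - d - (-e - m) = e - (d - 2 * m) by ring, show d + m - (m - d) = 2 * d by ring,
    show d + m - (-e - m) = e + 2 * m + d by ring, show d + m - (e - m) = d - (e - 2 * m) by ring]
  have w2' : theta τ 0 (e + 2 * m + d) * theta τ 0 (e - (d - 2 * m)) =
      theta2 τ 0 (e + 2 * m) * theta2 τ 1 d - theta2 τ 1 (e + 2 * m) * theta2 τ 0 d := by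
    rw [← w2]; ring_nf
  have w3' : theta τ 0 (d - (e - 2 * m)) * theta τ 0 (e + 2 * m + d) =
      theta2 τ 0 (d + 2 * m) * theta2 τ 1 e - theta2 τ 1 (d + 2 * m) * theta2 τ 0 e := by
    rw [← w3]; ring_nf
  have w4' : theta τ 0 (d - (e - 2 * m)) * theta τ 0 (e + (d - 2 * m)) =
      theta2 τ 0 d * theta2 τ 1 (e - 2 * m) - theta2 τ 1 d * theta2 τ 0 (e - 2 * m) := by
    rw [← w4]; ring_nf
  -- The relation holds already for the tensors `v(sᵢ + m) ⊗ v(sᵢ - m)`. By evenness of `v`, terms 1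
  -- and 3 share the second factor `v(d)`, and terms 2 and 4 share the first factor `v(e)`.
  have key : ∀ i j : Fin 2,
      theta τ 0 (e + (d - 2 * m)) * theta τ 0 (2 * e) * theta τ 0 (e - (d - 2 * m)) *
        (theta2 τ i (d + 2 * m) * theta2 τ j d)
      - theta τ 0 (2 * d) * theta τ 0 (e + 2 * m + d) * theta τ 0 (e - (d - 2 * m)) *
        (theta2 τ i e * theta2 τ j (e - 2 * m))
      + theta τ 0 (d - (e - 2 * m)) * theta τ 0 (e + 2 * m + d) * theta τ 0 (2 * e) *
        (theta2 τ i (d - 2 * m) * theta2 τ j d)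
      - theta τ 0 (d - (e - 2 * m)) * theta τ 0 (2 * d) * theta τ 0 (e + (d - 2 * m)) *
        (theta2 τ i e * theta2 τ j (e + 2 * m)) = 0 := by
    intro i j
    -- Three vectors in the plane satisfy `det(u,v) w + det(v,w) u + det(w,u) v = 0`, and the
    -- determinants are products of values of `θ₁` by `theta_zero_mul`. `t1` is this identity for
    -- the first tensor factors, `t2` for the second ones.
    have t1 : ∀ i : Fin 2,
        (theta2 τ 0 e * theta2 τ 1 (d - 2 * m) - theta2 τ 1 e * theta2 τ 0 (d - 2 * m)) *
          theta2 τ i (d + 2 * m) +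
        (theta2 τ 0 (d - 2 * m) * theta2 τ 1 (d + 2 * m) -
          theta2 τ 1 (d - 2 * m) * theta2 τ 0 (d + 2 * m)) * theta2 τ i e +
        (theta2 τ 0 (d + 2 * m) * theta2 τ 1 e - theta2 τ 1 (d + 2 * m) * theta2 τ 0 e) *
          theta2 τ i (d - 2 * m) = 0 :=
      Fin.forall_fin_two.mpr ⟨by ring, by ring⟩
    have t2 : ∀ j : Fin 2,
        (theta2 τ 0 (e + 2 * m) * theta2 τ 1 d - theta2 τ 1 (e + 2 * m) * theta2 τ 0 d) *
          theta2 τ j (e - 2 * m) +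
        (theta2 τ 0 d * theta2 τ 1 (e - 2 * m) - theta2 τ 1 d * theta2 τ 0 (e - 2 * m)) *
          theta2 τ j (e + 2 * m) +
        (theta2 τ 0 (e - 2 * m) * theta2 τ 1 (e + 2 * m) -
          theta2 τ 1 (e - 2 * m) * theta2 τ 0 (e + 2 * m)) * theta2 τ j d = 0 :=
      Fin.forall_fin_two.mpr ⟨by ring, by ring⟩
    have t1 := t1 i
    have t2 := t2 j
    rw [← w1, ← w5, ← w3'] at t1
    rw [← w2', ← w4', ← w6] at t2
    linear_combination theta τ 0 (2 * e) * theta2 τ j d * t1 - theta τ 0 (2 * d) * theta2 τ i e * t2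
  have ev1 : ∀ i, theta2 τ i (m - d + m) = theta2 τ i (d - 2 * m) := fun i => by
    rw [← theta2_neg]; ring_nf
  have ev2 : ∀ i, theta2 τ i (m - d - m) = theta2 τ i d := fun i => by
    rw [← theta2_neg]; ring_nf
  have ev4 : ∀ i, theta2 τ i (-e - m - m) = theta2 τ i (e + 2 * m) := fun i => by
    rw [← theta2_neg]; ring_nf
  apply mul_right_cancel₀ hc
  have split : ∀ s c, theta τ c (2 * s) * theta τ c (2 * m) =
      theta τ c (s + m + (s - m)) * theta τ c (s + m - (s - m)) := fun s c => by ring_nf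
  rw [zero_mul, sub_mul, add_mul, sub_mul, mul_assoc _ (theta τ c (2 * (d + m))),
    mul_assoc _ (theta τ c (2 * (e - m))), mul_assoc _ (theta τ c (2 * (m - d))),
    mul_assoc _ (theta τ c (2 * (-e - m))), split, split, split, split]
  have h00 := key 0 0
  have h01 := key 0 1
  have h10 := key 1 0
  have h11 := key 1 1
  have a1 : d + m + m = d + 2 * m := by ring
  have a2 : e - m - m = e - 2 * m := by ring
  -- It remains to contract the tensor identity with the `c`-th bilinear form.
  fin_cases c
  · simp only [Fin.zero_eta, theta_zero_mul hτ, ev1, ev2, ev4, a1, a2, add_sub_cancel_right,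
      sub_add_cancel, theta2_neg]
    linear_combination h01 - h10
  · simp only [Fin.mk_one, theta_one_mul hτ, ev1, ev2, ev4, a1, a2, add_sub_cancel_right,
      sub_add_cancel, theta2_neg]
    linear_combination h01 + h10
  · simp only [Fin.reduceFinMk, theta_two_mul hτ, ev1, ev2, ev4, a1, a2, add_sub_cancel_right,
      sub_add_cancel, theta2_neg]
    linear_combination h00 + h11
  · simp only [Fin.reduceFinMk, theta_three_mul hτ, ev1, ev2, ev4, a1, a2, add_sub_cancel_right,
      sub_add_cancel, theta2_neg]
    linear_combination h00 - h11

/-! ### Infinite products -/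

section Products

variable {ι : Type*} {c : ι → ℂ}

theorem summable_norm_neg_mul (hc : Summable fun i => ‖c i‖) (w : ℂ) :
    Summable fun i => ‖-(c i * w)‖ := by
  simpa using hc.mul_right ‖w‖

theorem multipliable_one_sub_mul (hc : Summable fun i => ‖c i‖) (w : ℂ) :
    Multipliable fun i => (1 - c i * w) := by
  simpa only [sub_eq_add_neg] using multipliable_one_add_of_summable (summable_norm_neg_mul hc w)

theorem tprod_one_sub_mul_ne_zero (hc : Summable fun i => ‖c i‖) {w : ℂ} (h : ∀ i, c i * w ≠ 1) :
    ∏' i, (1 - c i * w) ≠ 0 := by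
  simp_rw [sub_eq_add_neg]
  refine tprod_one_add_ne_zero_of_summable (fun i e => h i ?_) (summable_norm_neg_mul hc w)
  linear_combination -e

/-- On a ball of radius `‖w‖ + 1` the factors are dominated by a summable sequence, so the partial
products converge locally uniformly. -/
theorem differentiable_tprod_one_sub_mul (hc : Summable fun i => ‖c i‖) :
    Differentiable ℂ fun w => ∏' i, (1 - c i * w) := by
  intro w
  have hopen : IsOpen (Metric.ball (0 : ℂ) (‖w‖ + 1)) := Metric.isOpen_ball
  have h := Summable.hasProdLocallyUniformlyOn_one_add (f := fun i w => -(c i * w)) hopen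
    (hc.mul_right (‖w‖ + 1)) (Eventually.of_forall fun i x hx => ?_) (fun i => by fun_prop)
  · rw [hasProdLocallyUniformlyOn_iff_tendstoLocallyUniformlyOn] at h
    have hd := h.differentiableOn (Eventually.of_forall fun s => by fun_prop) hopen
    simp only [← sub_eq_add_neg] at hd
    exact hd.differentiableAt (hopen.mem_nhds (by simp))
  · rw [norm_neg, norm_mul]
    gcongr
    exact (mem_ball_zero_iff.mp hx).le

end Products

/-! ### The exponential and the products over one and two indices -/

/-- `exp (2πiz)`. -/
noncomputable def expTwoPi (z : ℂ) : ℂ := Complex.exp (2 * Real.pi * Complex.I * z)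

theorem expTwoPi_add (z w : ℂ) : expTwoPi (z + w) = expTwoPi z * expTwoPi w := by
  rw [expTwoPi, mul_add, Complex.exp_add]; rfl

theorem expTwoPi_ne_zero (z : ℂ) : expTwoPi z ≠ 0 := Complex.exp_ne_zero _

theorem expTwoPi_neg (z : ℂ) : expTwoPi (-z) = (expTwoPi z)⁻¹ := by
  rw [expTwoPi, mul_neg, Complex.exp_neg]; rfl

@[simp] theorem expTwoPi_zero : expTwoPi 0 = 1 := by simp [expTwoPi]

@[simp] theorem expTwoPi_one : expTwoPi 1 = 1 := by
  rw [expTwoPi, mul_one, Complex.exp_two_pi_mul_I]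

theorem differentiable_expTwoPi : Differentiable ℂ expTwoPi := by
  unfold expTwoPi
  fun_prop

theorem norm_expTwoPi (z : ℂ) : ‖expTwoPi z‖ = Real.exp (-(2 * Real.pi * z.im)) := by
  rw [expTwoPi, Complex.norm_exp]
  congr 1
  simp

theorem norm_expTwoPi_lt_one {z : ℂ} (hz : 0 < z.im) : ‖expTwoPi z‖ < 1 := by
  rw [norm_expTwoPi, Real.exp_lt_one_iff]
  have := Real.pi_pos
  have : 0 < 2 * Real.pi * z.im := by positivity
  linarith

theorem expTwoPi_eq_one_iff {z : ℂ} : expTwoPi z = 1 ↔ ∃ n : ℤ, z = n := by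
  rw [expTwoPi, Complex.exp_eq_one_iff]
  refine exists_congr fun n => ?_
  have := Complex.two_pi_I_ne_zero
  rw [mul_comm (n : ℂ)]
  exact mul_right_inj' this

theorem expTwoPi_nat_mul (σ : ℂ) (n : ℕ) : expTwoPi (σ * n) = expTwoPi σ ^ n := by
  rw [expTwoPi, expTwoPi, ← Complex.exp_nat_mul]
  ring_nf

theorem summable_norm_expTwoPi {σ : ℂ} (hσ : 0 < σ.im) :
    Summable fun n : ℕ => ‖expTwoPi (σ * n)‖ := by
  simp_rw [expTwoPi_nat_mul, norm_pow]
  exact summable_geometric_of_lt_one (norm_nonneg _) (norm_expTwoPi_lt_one hσ)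

theorem summable_norm_expTwoPi₂ {σ σ' : ℂ} (hσ : 0 < σ.im) (hσ' : 0 < σ'.im) :
    Summable fun p : ℕ × ℕ => ‖expTwoPi (σ * p.1 + σ' * p.2)‖ := by
  simp_rw [expTwoPi_add, norm_mul]
  exact (summable_norm_expTwoPi hσ).mul_of_nonneg (summable_norm_expTwoPi hσ')
    (fun _ => norm_nonneg _) (fun _ => norm_nonneg _)

/-- `∏_{n ≥ 0} (1 - e^{2πi(σn + z)})`. -/
noncomputable def qProd (σ z : ℂ) : ℂ := ∏' n : ℕ, (1 - expTwoPi (σ * n) * expTwoPi z)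

/-- `∏_{n, m ≥ 0} (1 - e^{2πi(σn + σ'm + z)})`. -/
noncomputable def qProd₂ (σ σ' z : ℂ) : ℂ :=
  ∏' p : ℕ × ℕ, (1 - expTwoPi (σ * p.1 + σ' * p.2) * expTwoPi z)

variable {σ σ' : ℂ}

theorem differentiable_qProd (hσ : 0 < σ.im) : Differentiable ℂ (qProd σ) :=
  (differentiable_tprod_one_sub_mul (summable_norm_expTwoPi hσ)).comp differentiable_expTwoPi

theorem differentiable_qProd₂ (hσ : 0 < σ.im) (hσ' : 0 < σ'.im) :
    Differentiable ℂ (qProd₂ σ σ') :=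
  (differentiable_tprod_one_sub_mul (summable_norm_expTwoPi₂ hσ hσ')).comp differentiable_expTwoPi

theorem qProd_add_one (σ z : ℂ) : qProd σ (z + 1) = qProd σ z := by
  simp only [qProd, expTwoPi_add z, expTwoPi_one, mul_one]

theorem qProd_eq_mul (hσ : 0 < σ.im) (z : ℂ) :
    qProd σ z = (1 - expTwoPi z) * qProd σ (z + σ) := by
  have hm : Multipliable fun n : ℕ => (1 - expTwoPi (σ * ((n + 1 : ℕ) : ℂ)) * expTwoPi z) := by
    refine (multipliable_one_sub_mul (summable_norm_expTwoPi hσ) (expTwoPi (z + σ))).congr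
      fun n => ?_
    rw [← expTwoPi_add, ← expTwoPi_add]
    push_cast
    ring_nf
  rw [qProd, tprod_eq_zero_mul' (f := fun n : ℕ => 1 - expTwoPi (σ * (n : ℂ)) * expTwoPi z) hm,
    qProd, Nat.cast_zero, mul_zero, expTwoPi_zero, one_mul]
  congr 1
  refine tprod_congr fun n => ?_
  rw [← expTwoPi_add, ← expTwoPi_add]
  push_cast
  ring_nf

theorem exists_of_qProd_eq_zero (hσ : 0 < σ.im) {z : ℂ} (h : qProd σ z = 0) :
    ∃ (m : ℤ) (n : ℕ), σ * n + z = m := by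
  by_contra! hne
  refine tprod_one_sub_mul_ne_zero (summable_norm_expTwoPi hσ) (w := expTwoPi z) (fun n e => ?_) h
  rw [← expTwoPi_add, expTwoPi_eq_one_iff] at e
  obtain ⟨m, hm⟩ := e
  exact hne m n hm

theorem qProd_ne_zero (hσ : 0 < σ.im) {z : ℂ} (hz : 0 < z.im) : qProd σ z ≠ 0 := by
  intro h
  obtain ⟨m, n, e⟩ := exists_of_qProd_eq_zero hσ h
  have := congrArg Complex.im e
  simp only [Complex.add_im, Complex.mul_im, Complex.natCast_re, Complex.natCast_im, mul_zero,
    zero_add, Complex.intCast_im] at this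
  have h2 : 0 ≤ σ.im * n := by positivity
  linarith

theorem qProd₂_ne_zero (hσ : 0 < σ.im) (hσ' : 0 < σ'.im) {z : ℂ} (hz : 0 < z.im) :
    qProd₂ σ σ' z ≠ 0 := by
  refine tprod_one_sub_mul_ne_zero (summable_norm_expTwoPi₂ hσ hσ') fun p e => ?_
  rw [← expTwoPi_add] at e
  have h := norm_expTwoPi_lt_one (z := σ * p.1 + σ' * p.2 + z) ?_
  · rw [e, norm_one] at h
    exact lt_irrefl _ h
  · simp only [Complex.add_im, Complex.mul_im, Complex.natCast_re, Complex.natCast_im, mul_zero,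
      zero_add]
    positivity

/-- The factors with second index `0` form `qProd σ z`; lowering the second index by one in the
others turns `z` into `z + σ'`. -/
theorem qProd₂_eq_mul (hσ : 0 < σ.im) (hσ' : 0 < σ'.im) (z : ℂ) :
    qProd₂ σ σ' z = qProd σ z * qProd₂ σ σ' (z + σ') := by
  have hm := multipliable_one_sub_mul (summable_norm_expTwoPi₂ hσ' hσ) (expTwoPi z)
  have hm' := multipliable_one_sub_mul (summable_norm_expTwoPi₂ hσ hσ') (expTwoPi (z + σ'))
  let e : ℕ ⊕ (ℕ × ℕ) ≃ ℕ × ℕ :=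
    { toFun := Sum.elim (fun n => (n, 0)) (fun p => (p.1, p.2 + 1))
      invFun := fun p => match p with
        | (n, 0) => .inl n
        | (n, m + 1) => .inr (n, m)
      left_inv := by rintro (n | ⟨n, m⟩) <;> rfl
      right_inv := by rintro ⟨n, _ | m⟩ <;> rfl }
  have h2 : (fun p : ℕ × ℕ => 1 - expTwoPi (σ * p.1 + σ' * p.2) * expTwoPi (z + σ')) =
      fun p : ℕ × ℕ => 1 - expTwoPi (σ * p.1 + σ' * ((p.2 + 1 : ℕ) : ℂ)) * expTwoPi z := by
    ext p
    rw [← expTwoPi_add, ← expTwoPi_add]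
    push_cast
    ring_nf
  rw [qProd₂, ← e.tprod_eq, Multipliable.tprod_sum, qProd, qProd₂]
  · congr 1
    · refine tprod_congr fun n => ?_
      simp [e]
    · rw [h2]
      rfl
  · refine (multipliable_one_sub_mul (summable_norm_expTwoPi hσ) (expTwoPi z)).congr fun n => ?_
    simp [e]
  · rw [h2] at hm'
    exact hm'

/-! ### The elliptic gamma function -/

theorem ellGamma_eq (τ τ' z : ℂ) :
    ellGamma τ τ' z = qProd₂ τ τ' (τ + τ' - z) / qProd₂ τ τ' z := by
  rw [ellGamma, qProd₂, qProd₂]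
  congr 1
  · refine tprod_congr fun p => ?_
    rw [← expTwoPi_add, expTwoPi]
    ring_nf
  · refine tprod_congr fun p => ?_
    rw [← expTwoPi_add, expTwoPi]

/-- The theta function in multiplicative form. -/
noncomputable def thetaProd (σ z : ℂ) : ℂ := qProd σ z * qProd σ (σ - z)

/-- Under `z ↦ z + σ'` the numerator gains the factor `qProd σ (σ - z)` and the denominator loses
`qProd σ z`. -/
theorem ellGamma_add (hσ : 0 < σ.im) (hσ' : 0 < σ'.im) {z : ℂ} (hz : qProd σ z ≠ 0) :
    ellGamma σ σ' (z + σ') = thetaProd σ z * ellGamma σ σ' z := by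
  rw [ellGamma_eq, ellGamma_eq, qProd₂_eq_mul hσ hσ' z, show σ + σ' - (z + σ') = σ - z by ring,
    qProd₂_eq_mul hσ hσ' (σ - z), show σ - z + σ' = σ + σ' - z by ring, thetaProd]
  field_simp

/-! ### Codiscrete sets -/

/-- Preimages of codiscrete sets under a nowhere locally constant analytic map are codiscrete. Thus
identities of meromorphic functions may be evaluated at shifted and rescaled arguments. -/
theorem tendsto_affine_codiscrete {α : ℂ} (hα : α ≠ 0) (β : ℂ) :
    Tendsto (fun z => α * z + β) (codiscrete ℂ) (codiscrete ℂ) := by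
  have ha : AnalyticOnNhd ℂ (fun z : ℂ => α * z + β) Set.univ := fun z _ => by fun_prop
  have h := ha.map_codiscreteWithin ?_
  · have himg : (fun z : ℂ => α * z + β) '' Set.univ = Set.univ := by
      rw [Set.image_univ, Set.range_eq_univ]
      exact fun w => ⟨(w - β) / α, by field_simp; ring⟩
    rw [himg] at h
    exact h
  · intro x _ hx
    obtain ⟨c, hc⟩ := eventuallyConst_iff_exists_eventuallyEq.mp hx
    have hd : HasDerivAt (fun z : ℂ => α * z + β) α x := by
      simpa using ((hasDerivAt_id x).const_mul α).add_const β
    exact hα (hd.unique ((hasDerivAt_const x c).congr_of_eventuallyEq hc))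

theorem eventually_codiscrete_affine {p : ℂ → Prop} (hp : ∀ᶠ z in codiscrete ℂ, p z) {α : ℂ}
    (hα : α ≠ 0) (β : ℂ) : ∀ᶠ z in codiscrete ℂ, p (α * z + β) :=
  (tendsto_affine_codiscrete hα β).eventually hp

theorem eventually_codiscrete_add {p : ℂ → Prop} (hp : ∀ᶠ z in codiscrete ℂ, p z) (β : ℂ) :
    ∀ᶠ z in codiscrete ℂ, p (z + β) := by
  simpa using eventually_codiscrete_affine hp one_ne_zero β

theorem eventually_codiscrete_ne_zero {f : ℂ → ℂ} (hf : Differentiable ℂ f) (h : ∃ w, f w ≠ 0) :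
    ∀ᶠ z in codiscrete ℂ, f z ≠ 0 := by
  obtain ⟨w, hw⟩ := h
  exact (Complex.analyticOnNhd_univ_iff_differentiable.mpr hf).preimage_zero_mem_codiscrete hw

theorem meromorphic_of_differentiable {f : ℂ → ℂ} (hf : Differentiable ℂ f) : Meromorphic f :=
  fun z => (hf.analyticAt z).meromorphicAt

theorem neBot_codiscrete : (codiscrete ℂ).NeBot := by
  refine ⟨fun h => ?_⟩
  have h0 : (∅ : Set ℂ) ∈ codiscrete ℂ := by rw [h]; exact mem_bot
  have := mem_codiscrete.mp h0 0
  rw [Set.compl_empty, principal_univ, disjoint_top] at this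
  exact NeBot.ne inferInstance this

/-! ### Doubly periodic functions -/

/-- All values are attained on a compact period parallelogram, so Liouville's theorem applies. -/
theorem eq_const_of_doubly_periodic {τ : ℂ} (hτ : 0 < τ.im) {φ : ℂ → ℂ} (hφ : Differentiable ℂ φ)
    (h1 : Function.Periodic φ 1) (h2 : Function.Periodic φ τ) (z w : ℂ) : φ z = φ w := by
  refine hφ.apply_eq_apply_of_bounded ?_ z w
  have hK : IsCompact ((fun p : ℝ × ℝ => (p.1 : ℂ) + p.2 * τ) '' (Set.Icc 0 1 ×ˢ Set.Icc 0 1)) :=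
    (isCompact_Icc.prod isCompact_Icc).image (by fun_prop)
  refine (hK.image hφ.continuous).isBounded.subset ?_
  rintro _ ⟨z, rfl⟩
  set y := z.im / τ.im with hy
  set x := z.re - y * τ.re with hx
  refine ⟨Int.fract x + Int.fract y * τ, ⟨(Int.fract x, Int.fract y),
    ⟨⟨Int.fract_nonneg x, (Int.fract_lt_one x).le⟩, ⟨Int.fract_nonneg y, (Int.fract_lt_one y).le⟩⟩,
    rfl⟩, ?_⟩
  have hz : z = x + y * τ := by
    apply Complex.ext
    · simp [hx]
    · simp only [Complex.add_im, Complex.ofReal_im, Complex.mul_im, Complex.ofReal_re, zero_mul,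
        add_zero, zero_add, hy]
      field_simp
  have e : z = ((Int.fract x : ℝ) : ℂ) + (Int.fract y : ℝ) * τ + ⌊y⌋ * τ + ⌊x⌋ * 1 := by
    have ex : (x : ℂ) = ((Int.fract x : ℝ) : ℂ) + ⌊x⌋ := by
      exact_mod_cast (Int.fract_add_floor x).symm
    have ey : (y : ℂ) = ((Int.fract y : ℝ) : ℂ) + ⌊y⌋ := by
      exact_mod_cast (Int.fract_add_floor y).symm
    rw [hz]
    nth_rewrite 1 [ex, ey]
    ring
  conv_rhs => rw [e, h1.int_mul, h2.int_mul]

/-! ### The product formula for the first theta function -/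

variable {τ : ℂ}

theorem thetaProd_eq_mul (hτ : 0 < τ.im) (z : ℂ) :
    thetaProd τ z = (1 - expTwoPi z) * (qProd τ (z + τ) * qProd τ (τ - z)) := by
  rw [thetaProd, qProd_eq_mul hτ z]
  ring

theorem thetaProd_add_one (τ z : ℂ) : thetaProd τ (z + 1) = thetaProd τ z := by
  rw [thetaProd, thetaProd, qProd_add_one, ← qProd_add_one τ (τ - (z + 1))]
  ring_nf

theorem thetaProd_add_tau (hτ : 0 < τ.im) (z : ℂ) :
    thetaProd τ (z + τ) = -expTwoPi (-z) * thetaProd τ z := by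
  have h1 := qProd_eq_mul hτ (-z)
  rw [show -z + τ = τ - z by ring] at h1
  have h : thetaProd τ (z + τ) = (1 - expTwoPi (-z)) * (qProd τ (z + τ) * qProd τ (τ - z)) := by
    rw [thetaProd, show τ - (z + τ) = -z by ring, h1]
    ring
  rw [h, thetaProd_eq_mul hτ, expTwoPi_neg]
  have := expTwoPi_ne_zero z
  field_simp
  ring

theorem exists_of_thetaProd_eq_zero (hτ : 0 < τ.im) {z : ℂ} (h : thetaProd τ z = 0) :
    ∃ m n : ℤ, z = m + n * τ := by
  rcases mul_eq_zero.mp h with h | h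
  · obtain ⟨m, n, e⟩ := exists_of_qProd_eq_zero hτ h
    exact ⟨m, -n, by push_cast; linear_combination e⟩
  · obtain ⟨m, n, e⟩ := exists_of_qProd_eq_zero hτ h
    exact ⟨-m, n + 1, by push_cast; linear_combination -e⟩

theorem differentiable_thetaProd (hτ : 0 < τ.im) : Differentiable ℂ (thetaProd τ) := by
  have := differentiable_qProd hτ
  unfold thetaProd
  fun_prop

theorem theta_zero_add_one (τ z : ℂ) : theta τ 0 (z + 1) = -theta τ 0 z := by
  have h := thetaChar_add_one (1 / 2) (1 / 2) τ z
  rw [exp_two_pi_half] at h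
  simpa [theta] using h

theorem theta_zero_add_tau (τ z : ℂ) : theta τ 0 (z + τ) =
    -Complex.exp (-(Real.pi * Complex.I * τ)) * expTwoPi (-z) * theta τ 0 z := by
  have h := thetaChar_add_tau (1 / 2) (1 / 2) τ z
  have e : Complex.exp (-(Real.pi * Complex.I * τ) - 2 * Real.pi * Complex.I * (z + 1 / 2)) =
      -Complex.exp (-(Real.pi * Complex.I * τ)) * expTwoPi (-z) := by
    rw [show -(Real.pi * Complex.I * τ) - 2 * Real.pi * Complex.I * (z + 1 / 2) =
      -(Real.pi * Complex.I * τ) + 2 * Real.pi * Complex.I * -z - Real.pi * Complex.I by ring,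
      Complex.exp_sub, Complex.exp_pi_mul_I, Complex.exp_add, expTwoPi]
    ring
  rw [e] at h
  exact h

/-- `θ₁` is proportional to its product expansion. -/
theorem exists_theta_zero_eq (hτ : 0 < τ.im) : ∃ C : ℂ, ∀ z, thetaProd τ z ≠ 0 →
    Complex.exp (Real.pi * Complex.I * z) * theta τ 0 z = C * thetaProd τ z := by
  obtain ⟨f, hf⟩ : ∃ f : ℂ → ℂ, f = fun z => Complex.exp (Real.pi * Complex.I * z) * theta τ 0 z :=
    ⟨_, rfl⟩
  have hfd : Differentiable ℂ f := by
    have := differentiable_theta hτ 0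
    rw [hf]
    fun_prop
  have hf1 : ∀ z, f (z + 1) = f z := by
    intro z
    simp only [hf, theta_zero_add_one, mul_add, Complex.exp_add, mul_one, Complex.exp_pi_mul_I]
    ring
  have hfτ : ∀ z, f (z + τ) = -expTwoPi (-z) * f z := by
    intro z
    simp only [hf, theta_zero_add_tau, mul_add, Complex.exp_add, Complex.exp_neg]
    have := Complex.exp_ne_zero (Real.pi * Complex.I * τ)
    field_simp
  have hf0 : f 0 = 0 := by simp [hf, theta_zero_zero]
  -- `G` is `thetaProd τ z / z` with its singularity removed; `G 0 ≠ 0` says that the zero at the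
  -- origin is simple.
  obtain ⟨G, hG⟩ : ∃ G : ℂ → ℂ, G = fun z => dslope (fun z => 1 - expTwoPi z) 0 z *
      (qProd τ (z + τ) * qProd τ (τ - z)) := ⟨_, rfl⟩
  have hdiff_dslope : ∀ {g : ℂ → ℂ}, Differentiable ℂ g → Differentiable ℂ (dslope g 0) := by
    intro g hg
    rw [← differentiableOn_univ] at hg ⊢
    exact (Complex.differentiableOn_dslope univ_mem).mpr hg
  have hexp := differentiable_expTwoPi
  have hGd : Differentiable ℂ G := by
    have h1 := differentiable_qProd hτ
    have h2 := hdiff_dslope (g := fun z => 1 - expTwoPi z) (by fun_prop)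
    rw [hG]
    fun_prop
  have hGz : ∀ z, thetaProd τ z = z * G z := by
    intro z
    have h := sub_smul_dslope (fun z => 1 - expTwoPi z) 0 z
    simp only [sub_zero, smul_eq_mul, expTwoPi_zero, sub_self] at h
    simp only [hG]
    rw [thetaProd_eq_mul hτ, ← h]
    ring
  have hG0 : G 0 ≠ 0 := by
    simp only [hG, dslope_same, zero_add, sub_zero]
    refine mul_ne_zero ?_ (mul_ne_zero (qProd_ne_zero hτ hτ) (qProd_ne_zero hτ hτ))
    have : HasDerivAt (fun z => 1 - expTwoPi z) (-(2 * Real.pi * Complex.I)) 0 := by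
      have h := (((hasDerivAt_id (0 : ℂ)).const_mul (2 * Real.pi * Complex.I)).cexp).const_sub 1
      simpa [expTwoPi] using h
    rw [this.deriv]
    exact neg_ne_zero.mpr Complex.two_pi_I_ne_zero
  have hfz : ∀ z, f z = z * dslope f 0 z := by
    intro z
    have h := sub_smul_dslope f 0 z
    simpa [hf0] using h.symm
  -- `φ` is the quotient of two functions with the same quasi-periods. At every zero of the
  -- denominator it receives the limit of the quotient at `0`; the zeros are lattice points, so `φ`
  -- is doubly periodic and its differentiability there reduces to that at `0`.
  obtain ⟨φ, hφ⟩ : ∃ φ : ℂ → ℂ, φ = fun z =>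
      if thetaProd τ z = 0 then dslope f 0 0 / G 0 else f z / thetaProd τ z := ⟨_, rfl⟩
  have hφ1 : Function.Periodic φ 1 := fun z => by
    simp only [hφ, thetaProd_add_one, hf1]
  have hφτ : Function.Periodic φ τ := fun z => by
    have he : -expTwoPi (-z) ≠ 0 := neg_ne_zero.mpr (expTwoPi_ne_zero _)
    simp only [hφ, thetaProd_add_tau hτ, hfτ, mul_eq_zero, he, false_or,
      mul_div_mul_left _ _ he]
  have hφ0 : DifferentiableAt ℂ φ 0 := by
    have hq : DifferentiableAt ℂ (fun z => dslope f 0 z / G z) 0 :=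
      (hdiff_dslope hfd 0).div (hGd 0) hG0
    refine hq.congr_of_eventuallyEq ?_
    filter_upwards [(hGd 0).continuousAt.eventually_ne hG0] with z hz
    simp only [hφ]
    by_cases h0 : z = 0
    · rw [h0, if_pos (by rw [hGz, zero_mul])]
    · rw [if_neg (by rw [hGz]; exact mul_ne_zero h0 hz), hfz, hGz, mul_div_mul_left _ _ h0]
  have hφd : Differentiable ℂ φ := by
    intro z
    by_cases hz : thetaProd τ z = 0
    · obtain ⟨m, n, rfl⟩ := exists_of_thetaProd_eq_zero hτ hz
      have hshift : φ = fun z => φ (z - (m + n * τ)) := by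
        ext z
        have h := hφτ.int_mul n (z - (m + n * τ))
        have h' := hφ1.int_mul m (z - (m + n * τ) + n * τ)
        rw [← h, ← h']
        ring_nf
      rw [hshift]
      refine DifferentiableAt.comp (g := φ) (m + n * τ : ℂ) ?_ (by fun_prop)
      simpa using hφ0
    · have hq : DifferentiableAt ℂ (fun z => f z / thetaProd τ z) z :=
        (hfd z).div (differentiable_thetaProd hτ z) hz
      refine hq.congr_of_eventuallyEq ?_
      filter_upwards [(differentiable_thetaProd hτ z).continuousAt.eventually_ne hz] with w hw
      simp only [hφ]
      rw [if_neg hw]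
  refine ⟨φ 0, fun z hz => ?_⟩
  have h := eq_const_of_doubly_periodic hτ hφd hφ1 hφτ z 0
  rw [← h]
  simp only [hφ, if_neg hz, hf]
  field_simp

/-! ### Products of difference operators -/

/-- The coefficients of `T S` as a linear function of `S`. -/
def shiftMulLeft (b : ℂ) (T : ShiftCoeffs) (n : ℕ) (z : ℂ) : ShiftCoeffs →ₗ[ℂ] ℂ where
  toFun S := shiftMul b T S n z
  map_add' S S' := by simp [shiftMul, mul_add, Finset.sum_add_distrib]
  map_smul' c S := by
    simp only [shiftMul, Pi.smul_apply, smul_eq_mul, RingHom.id_apply, Finset.mul_sum]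
    exact Finset.sum_congr rfl fun k _ => by ring

/-- The coefficients of `S T` as a linear function of `S`. -/
def shiftMulRight (b : ℂ) (T : ShiftCoeffs) (n : ℕ) (z : ℂ) : ShiftCoeffs →ₗ[ℂ] ℂ where
  toFun S := shiftMul b S T n z
  map_add' S S' := by simp [shiftMul, add_mul, Finset.sum_add_distrib]
  map_smul' c S := by
    simp only [shiftMul, Pi.smul_apply, smul_eq_mul, RingHom.id_apply, Finset.mul_sum]
    exact Finset.sum_congr rfl fun k _ => by ring

theorem laxRelShift_of_gen {b : ℂ} {T : ShiftCoeffs} {w : Fin 4 → ℂ} {S S' : Fin 4 → ShiftCoeffs}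
    (h : ∀ c, ShiftEq (shiftMul b T (S c)) (shiftMul 1 (S' c) T)) :
    LaxRelShift b T (lax w S) (lax w S') := by
  intro i j n
  have h' : ∀ᶠ z in codiscrete ℂ, ∀ c, shiftMul b T (S c) n z = shiftMul 1 (S' c) T n z :=
    eventually_all.mpr fun c => h c n
  filter_upwards [h'] with z hz
  exact (map_lax (shiftMulLeft b T n z) w S i j).trans
    ((lax_congr hz i j).trans (map_lax (shiftMulRight 1 T n z) w S' i j).symm)

theorem gen_of_laxRelShift {b : ℂ} {T : ShiftCoeffs} {w : Fin 4 → ℂ} {S S' : Fin 4 → ShiftCoeffs}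
    (hw : ∀ c, w c ≠ 0) (h : LaxRelShift b T (lax w S) (lax w S')) (c : Fin 4) :
    ShiftEq (shiftMul b T (S c)) (shiftMul 1 (S' c) T) := by
  intro n
  have h' : ∀ᶠ z in codiscrete ℂ, ∀ i j, shiftMul b T (lax w S i j) n z =
      shiftMul 1 (lax w S' i j) T n z :=
    eventually_all.mpr fun i => eventually_all.mpr fun j => h i j n
  filter_upwards [h'] with z hz
  refine mul_left_cancel₀ (hw c) (smul_eq_smul_of_lax_eq (w := w)
    (x := fun c => shiftMul b T (S c) n z) (y := fun c => shiftMul 1 (S' c) T n z) ?_ c)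
  intro i j
  exact (map_lax (shiftMulLeft b T n z) w S i j).symm.trans
    ((hz i j).trans (map_lax (shiftMulRight 1 T n z) w S' i j))

theorem genE_add_two (τ η l : ℂ) (c : Fin 4) (n : ℕ) (z : ℂ) : genE τ η l c (n + 2) z = 0 := by
  simp [genE]

theorem shiftMul_genE_zero (τ η l b : ℂ) (c : Fin 4) (T : ShiftCoeffs) (z : ℂ) :
    shiftMul b T (genE τ η l c) 0 z = T 0 z * genE τ η l c 0 (z + b) := by
  simp [shiftMul]

/-- A generator has only the two coefficients of index `0` and `1`, so just the last two terms of
the convolution survive. -/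
theorem shiftMul_genE_succ (τ η l b : ℂ) (c : Fin 4) (T : ShiftCoeffs) (n : ℕ) (z : ℂ) :
    shiftMul b T (genE τ η l c) (n + 1) z =
      T (n + 1) z * genE τ η l c 0 (z + b - 2 * (n + 1)) +
        T n z * genE τ η l c 1 (z + b - 2 * n) := by
  rw [shiftMul, Finset.sum_range_succ, Finset.sum_range_succ, Finset.sum_eq_zero]
  · rw [Nat.sub_self, Nat.add_sub_cancel_left]
    push_cast
    ring
  · intro k hk
    obtain ⟨m, hm⟩ := Nat.exists_eq_add_of_lt (Finset.mem_range.mp hk)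
    rw [show n + 1 - k = m + 2 by omega, genE_add_two, mul_zero]

theorem genE_shiftMul_zero (τ η l : ℂ) (c : Fin 4) (T : ShiftCoeffs) (z : ℂ) :
    shiftMul 1 (genE τ η l c) T 0 z = genE τ η l c 0 z * T 0 (z + 1) := by
  simp [shiftMul]

theorem genE_shiftMul_succ (τ η l : ℂ) (c : Fin 4) (T : ShiftCoeffs) (n : ℕ) (z : ℂ) :
    shiftMul 1 (genE τ η l c) T (n + 1) z =
      genE τ η l c 0 z * T (n + 1) (z + 1) + genE τ η l c 1 z * T n (z - 1) := by
  rw [shiftMul, Finset.sum_range_succ', Finset.sum_range_succ', Finset.sum_eq_zero]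
  · simp only [zero_add, Nat.add_sub_cancel, Nat.sub_zero, Nat.cast_one, Nat.cast_zero]
    rw [show z + 1 - 2 * 1 = z - 1 by ring, show z + 1 - 2 * 0 = z + 1 by ring]
    ring
  · intro k _
    rw [genE_add_two, zero_mul]

/-! ### Elliptic numbers and the elliptic gamma function -/

section Elliptic

variable {τ η : ℂ}

theorem ell_neg (τ η x : ℂ) : ell τ η (-x) = -ell τ η x := by
  rw [ell, mul_neg, theta_zero_neg, ell]

theorem differentiable_ell (hτ : 0 < τ.im) : Differentiable ℂ (ell τ η) := by
  have := differentiable_theta hτ 0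
  unfold ell
  fun_prop

theorem ne_zero_of_im_pos (hη : 0 < η.im) : η ≠ 0 := by
  rintro rfl
  simp at hη

theorem exists_theta_ne_zero_of_ell (hell : ∀ k : ℕ, 1 ≤ k → ell τ η k ≠ 0) (c : Fin 4) :
    ∃ z, theta τ c z ≠ 0 := by
  have h := hell 1 le_rfl
  exact exists_theta_ne_zero (c := 0) h c

theorem eventually_ell_ne_zero (hτ : 0 < τ.im) (hell : ∀ k : ℕ, 1 ≤ k → ell τ η k ≠ 0) (β : ℂ) :
    ∀ᶠ z in codiscrete ℂ, ell τ η (z + β) ≠ 0 :=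
  eventually_codiscrete_add
    (eventually_codiscrete_ne_zero (differentiable_ell hτ) ⟨_, hell 1 le_rfl⟩) β

theorem eventually_theta_ne_zero (hτ : 0 < τ.im) (hη : 0 < η.im)
    (hell : ∀ k : ℕ, 1 ≤ k → ell τ η k ≠ 0) (c : Fin 4) (β : ℂ) :
    ∀ᶠ z in codiscrete ℂ, theta τ c (2 * η * z + β) ≠ 0 :=
  eventually_codiscrete_affine (eventually_codiscrete_ne_zero (differentiable_theta hτ c)
    (exists_theta_ne_zero_of_ell hell c)) (mul_ne_zero two_ne_zero (ne_zero_of_im_pos hη)) β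

theorem eventually_ellPoch_ne_zero (hτ : 0 < τ.im) (hell : ∀ k : ℕ, 1 ≤ k → ell τ η k ≠ 0)
    (k : ℕ) : ∀ᶠ z in codiscrete ℂ, ellPoch τ η (-z + 1) k ≠ 0 := by
  have h : ∀ᶠ z in codiscrete ℂ, ∀ j ∈ Finset.range k, ell τ η (z + (-1 - (j : ℂ))) ≠ 0 :=
    (eventually_all_finset _).mpr fun j _ => eventually_ell_ne_zero hτ hell _
  filter_upwards [h] with z hz
  refine Finset.prod_ne_zero_iff.mpr fun j hj => ?_
  rw [show -z + 1 + (j : ℂ) = -(z + (-1 - (j : ℂ))) by ring, ell_neg]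
  exact neg_ne_zero.mpr (hz j hj)

theorem ellFact_ne_zero (hell : ∀ k : ℕ, 1 ≤ k → ell τ η k ≠ 0) (k : ℕ) : ellFact τ η k ≠ 0 := by
  refine Finset.prod_ne_zero_iff.mpr fun j _ => ?_
  have := hell (j + 1) (by omega)
  push_cast at this
  exact this

theorem two_mul_im_pos (hη : 0 < η.im) : 0 < (2 * η).im := by simpa using hη

theorem eventually_gam_ne_zero (hτ : 0 < τ.im) (hη : 0 < η.im) (β : ℂ) :
    ∀ᶠ z in codiscrete ℂ, gam τ η (2 * z + β) ≠ 0 := by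
  have hη2 := two_mul_im_pos hη
  have hd := differentiable_qProd₂ hτ hη2
  have hI : 0 < Complex.I.im := by simp
  have h1 := eventually_codiscrete_ne_zero hd ⟨Complex.I, qProd₂_ne_zero hτ hη2 hI⟩
  have hη0 := ne_zero_of_im_pos hη
  have h2 := eventually_codiscrete_affine h1 (mul_ne_zero two_ne_zero hη0) (η * β)
  have h3 := eventually_codiscrete_affine h1 (neg_ne_zero.mpr (mul_ne_zero two_ne_zero hη0))
    (τ + 2 * η - η * β)
  filter_upwards [h2, h3] with z h2 h3
  rw [gam, ellGamma_eq]
  refine div_ne_zero ?_ ?_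
  · convert h3 using 2
    ring
  · convert h2 using 2
    ring

theorem meromorphic_gam (hτ : 0 < τ.im) (hη : 0 < η.im) (β : ℂ) :
    Meromorphic fun z => gam τ η (2 * z + β) := by
  have hd := differentiable_qProd₂ hτ (two_mul_im_pos hη)
  simp only [gam, ellGamma_eq]
  exact Meromorphic.fun_div (meromorphic_of_differentiable (by fun_prop))
    (meromorphic_of_differentiable (by fun_prop))

theorem meromorphic_interE (hτ : 0 < τ.im) (hη : 0 < η.im) (a : ℂ) (k : ℕ) :
    Meromorphic (interE τ η a k) := by
  have hd := differentiable_ell (η := η) hτ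
  have hg := meromorphic_gam hτ hη 0
  simp only [add_zero] at hg
  have hP : ∀ (g : ℂ → ℂ), Differentiable ℂ g → Differentiable ℂ fun z => ellPoch τ η (g z) k := by
    intro g hg
    unfold ellPoch
    fun_prop
  have hP1 := hP (fun z => -z - a) (by fun_prop)
  have hP2 := hP (fun z => -z + 1) (by fun_prop)
  unfold interE
  refine Meromorphic.fun_mul (Meromorphic.fun_div (Meromorphic.fun_mul ?_ hg)
    (meromorphic_gam hτ hη (2 * a))) (Meromorphic.fun_div ?_ ?_)
  all_goals exact meromorphic_of_differentiable (by fun_prop)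

/-- The quotient of values of the elliptic gamma function at points that differ by `2`. -/
theorem exists_eventually_gam_add (hτ : 0 < τ.im) (hη : 0 < η.im)
    (hell : ∀ k : ℕ, 1 ≤ k → ell τ η k ≠ 0) : ∃ C : ℂ, C ≠ 0 ∧ ∀ β : ℂ, ∀ᶠ z in codiscrete ℂ,
      C * gam τ η (2 * (z + 1) + 2 * β) = Complex.exp (Real.pi * Complex.I * (2 * η * (z + β))) *
        ell τ η (z + β) * gam τ η (2 * z + 2 * β) := by
  have hη2 := two_mul_im_pos hη
  have hη0 : 2 * η ≠ 0 := mul_ne_zero two_ne_zero (ne_zero_of_im_pos hη)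
  have hI : 0 < Complex.I.im := by simp
  obtain ⟨C, hC⟩ := exists_theta_zero_eq hτ
  have hq1 := eventually_codiscrete_ne_zero (differentiable_qProd hτ)
    ⟨Complex.I, qProd_ne_zero hτ hI⟩
  have hq2 : ∀ᶠ z in codiscrete ℂ, qProd τ (τ - z) ≠ 0 := by
    have := eventually_codiscrete_affine hq1 (neg_ne_zero.mpr one_ne_zero) τ
    filter_upwards [this] with z hz
    convert hz using 2
    ring
  have hq : ∀ᶠ z in codiscrete ℂ, qProd τ z ≠ 0 ∧ thetaProd τ z ≠ 0 := by
    filter_upwards [hq1, hq2] with z h1 h2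
    exact ⟨h1, mul_ne_zero h1 h2⟩
  refine ⟨C, ?_, fun β => ?_⟩
  -- If `C` were zero, `θ₁` would vanish off a discrete set.
  · rintro rfl
    have hev := eventually_codiscrete_ne_zero (differentiable_theta hτ 0)
      (exists_theta_ne_zero_of_ell hell 0)
    have := neBot_codiscrete
    obtain ⟨z, hz1, hz2⟩ := (hq.and hev).exists
    have := hC z hz1.2
    rw [zero_mul] at this
    exact mul_ne_zero (Complex.exp_ne_zero _) hz2 this
  · filter_upwards [eventually_codiscrete_affine hq hη0 (2 * η * β)] with z hz
    rw [← mul_add] at hz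
    have h1 := ellGamma_add hτ hη2 hz.1
    have h2 := hC _ hz.2
    rw [gam, gam, show η * (2 * (z + 1) + 2 * β) = 2 * η * (z + β) + 2 * η by ring, h1,
      show η * (2 * z + 2 * β) = 2 * η * (z + β) by ring, ell, h2]
    ring

/-! ### The elliptic operator -/

theorem interE_zero_apply (τ η a z : ℂ) (hz : ell τ η (z + a) ≠ 0) : interE τ η a 0 z =
    Complex.exp (2 * Real.pi * Complex.I * a * η * z + Real.pi * Complex.I * η * a ^ 2) *
      gam τ η (2 * z) / gam τ η (2 * z + 2 * a) := by
  have h : ell τ η (-z - a) ≠ 0 := by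
    rw [show -z - a = -(z + a) by ring, ell_neg]
    exact neg_ne_zero.mpr hz
  simp [interE, ellPoch, ellFact, h]

theorem eventually_interE_zero_ne_zero (hτ : 0 < τ.im) (hη : 0 < η.im)
    (hell : ∀ k : ℕ, 1 ≤ k → ell τ η k ≠ 0) (a : ℂ) :
    ∀ᶠ z in codiscrete ℂ, interE τ η a 0 z ≠ 0 := by
  filter_upwards [eventually_ell_ne_zero hτ hell a, eventually_gam_ne_zero hτ hη 0,
    eventually_gam_ne_zero hτ hη (2 * a)] with z h1 h2 h3
  rw [interE_zero_apply _ _ _ _ h1]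
  rw [add_zero] at h2
  exact div_ne_zero (mul_ne_zero (Complex.exp_ne_zero _) h2) h3

/-- The step `z ↦ z + 1` moves the arguments of both elliptic gamma functions by the period `2η`,
which yields the quotient of `ell` values. The linear exponential in `W` cancels the exponentials
that accompany them (`e3`). -/
theorem eventually_interE_zero_add_one (hτ : 0 < τ.im) (hη : 0 < η.im)
    (hell : ∀ k : ℕ, 1 ≤ k → ell τ η k ≠ 0) (a : ℂ) : ∀ᶠ z in codiscrete ℂ,
      interE τ η a 0 (z + 1) = interE τ η a 0 z * (ell τ η z / ell τ η (z + a)) := by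
  obtain ⟨C, hC, hgam⟩ := exists_eventually_gam_add hτ hη hell
  have ha := eventually_ell_ne_zero hτ hell a
  have hg := eventually_gam_ne_zero hτ hη (2 * a)
  filter_upwards [ha, eventually_codiscrete_add ha 1, hgam 0, hgam a, hg,
    eventually_codiscrete_add hg 1] with z h1 h2 h3 h4 h5 h6
  rw [interE_zero_apply _ _ _ _ h1, interE_zero_apply _ _ _ _ h2]
  simp only [mul_zero, add_zero] at h3
  have e1 : gam τ η (2 * (z + 1)) = Complex.exp (Real.pi * Complex.I * (2 * η * z)) *
      ell τ η z * gam τ η (2 * z) / C := by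
    rw [← h3]
    field_simp
  have e2 : gam τ η (2 * (z + 1) + 2 * a) = Complex.exp (Real.pi * Complex.I * (2 * η * (z + a))) *
      ell τ η (z + a) * gam τ η (2 * z + 2 * a) / C := by
    rw [← h4]
    field_simp
  have e3 : Complex.exp (2 * Real.pi * Complex.I * a * η * (z + 1) +
      Real.pi * Complex.I * η * a ^ 2) * Complex.exp (Real.pi * Complex.I * (2 * η * z)) =
      Complex.exp (2 * Real.pi * Complex.I * a * η * z + Real.pi * Complex.I * η * a ^ 2) *
        Complex.exp (Real.pi * Complex.I * (2 * η * (z + a))) := by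
    rw [← Complex.exp_add, ← Complex.exp_add]
    ring_nf
  rw [e1, e2]
  have := Complex.exp_ne_zero (Real.pi * Complex.I * (2 * η * (z + a)))
  generalize Complex.exp (2 * Real.pi * Complex.I * a * η * (z + 1) +
      Real.pi * Complex.I * η * a ^ 2) = x₁ at *
  generalize Complex.exp (2 * Real.pi * Complex.I * a * η * z +
    Real.pi * Complex.I * η * a ^ 2) = x₂ at *
  generalize Complex.exp (Real.pi * Complex.I * (2 * η * z)) = x₃ at *
  generalize Complex.exp (Real.pi * Complex.I * (2 * η * (z + a))) = x₄ at *
  generalize gam τ η (2 * z + 2 * a) = y at *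
  generalize gam τ η (2 * z) = y' at *
  field_simp
  linear_combination y' * ell τ η z * e3

theorem eventually_interE_succ (hτ : 0 < τ.im)
    (hell : ∀ k : ℕ, 1 ≤ k → ell τ η k ≠ 0) (a : ℂ) (n : ℕ) : ∀ᶠ z in codiscrete ℂ,
      interE τ η a (n + 1) z = interE τ η a n z *
        (ell τ η (z + a - 2 * n - 2) * ell τ η (z + a - n) * ell τ η (n - a) /
          (ell τ η (z + a - 2 * n) * ell τ η (z - n - 1) * ell τ η (n + 1))) := by
  filter_upwards [eventually_ell_ne_zero hτ hell (a - 2 * n),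
    eventually_ell_ne_zero hτ hell (-n - 1), eventually_ellPoch_ne_zero hτ hell n,
    eventually_ell_ne_zero hτ hell a] with z h1 h2 h3 h4
  have h5 := hell (n + 1) (by omega)
  have h6 := ellFact_ne_zero hell n
  push_cast at h5
  rw [← add_sub_assoc] at h1
  rw [show z + (-n - 1) = z - n - 1 by ring] at h2
  simp only [interE]
  have s1 : ∀ x, ellPoch τ η x (n + 1) = ellPoch τ η x n * ell τ η (x + n) :=
    fun x => Finset.prod_range_succ _ _
  have s2 : ellFact τ η (n + 1) = ellFact τ η n * ell τ η (n + 1) := Finset.prod_range_succ _ _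
  rw [s1, s1, s1, s2]
  push_cast
  rw [show -z - a + 2 * ((n : ℂ) + 1) = -(z + a - 2 * n - 2) by ring,
    show -z - a + 2 * (n : ℂ) = -(z + a - 2 * n) by ring,
    show -z - a + (n : ℂ) = -(z + a - n) by ring,
    show -z + 1 + (n : ℂ) = -(z - n - 1) by ring,
    show -a + (n : ℂ) = n - a by ring, ell_neg, ell_neg, ell_neg, ell_neg]
  have h7 : ell τ η (-z - a) ≠ 0 := by
    rw [show -z - a = -(z + a) by ring, ell_neg]
    exact neg_ne_zero.mpr h4
  generalize Complex.exp (2 * Real.pi * Complex.I * a * η * z + Real.pi * Complex.I * η * a ^ 2) *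
      gam τ η (2 * z) / gam τ η (2 * z + 2 * a) = G
  field_simp

/-- The ratio is known for `n = 0`, and the induction step divides `eventually_interE_succ` at `z +
1` by the same relation at `z`. -/
theorem eventually_interE_add_one (hτ : 0 < τ.im) (hη : 0 < η.im)
    (hell : ∀ k : ℕ, 1 ≤ k → ell τ η k ≠ 0) (a : ℂ) (n : ℕ) : ∀ᶠ z in codiscrete ℂ,
      interE τ η a n (z + 1) = interE τ η a n z *
        (ell τ η (z + a - 2 * n + 1) * ell τ η (z - n) /
          (ell τ η (z + a - 2 * n) * ell τ η (z + a - n + 1))) := by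
  induction n with
  | zero =>
    filter_upwards [eventually_interE_zero_add_one hτ hη hell a,
      eventually_ell_ne_zero hτ hell (a + 1)] with z h1 h2
    rw [← add_assoc] at h2
    rw [h1]
    simp only [Nat.cast_zero, mul_zero, sub_zero]
    rw [mul_comm (ell τ η (z + a)), mul_div_mul_left _ _ h2]
  | succ n ih =>
    have hs := eventually_interE_succ hτ hell a n
    filter_upwards [hs, eventually_codiscrete_add hs 1, ih,
      eventually_ell_ne_zero hτ hell (a - 2 * n), eventually_ell_ne_zero hτ hell (a - 2 * n + 1),
      eventually_ell_ne_zero hτ hell (-n), eventually_ell_ne_zero hτ hell (a - n + 1),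
      eventually_ell_ne_zero hτ hell (a - 2 * n - 2), eventually_ell_ne_zero hτ hell (a - n),
      eventually_ell_ne_zero hτ hell (-n - 1)]
      with z h1 h2 h3 e1 e2 e3 e4 e5 e6 e7
    rw [h2, h3, h1]
    have e8 := hell (n + 1) (by omega)
    push_cast at e8 ⊢
    rw [show z + (a - 2 * n) = z + a - 2 * n by ring] at e1
    rw [show z + (a - 2 * n + 1) = z + a - 2 * n + 1 by ring] at e2
    rw [show z + -(n : ℂ) = z - n by ring] at e3
    rw [show z + (a - n + 1) = z + a - n + 1 by ring] at e4
    rw [show z + (a - 2 * n - 2) = z + a - 2 * n - 2 by ring] at e5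
    rw [show z + (a - n) = z + a - n by ring] at e6
    rw [show z + (-(n : ℂ) - 1) = z - n - 1 by ring] at e7
    rw [show z + 1 + a - 2 * n - 2 = z + a - 2 * n - 1 by ring,
      show z + 1 + a - n = z + a - n + 1 by ring,
      show z + 1 + a - 2 * n = z + a - 2 * n + 1 by ring,
      show z + 1 - n - 1 = z - n by ring,
      show z + a - 2 * ((n : ℂ) + 1) + 1 = z + a - 2 * n - 1 by ring,
      show z - ((n : ℂ) + 1) = z - n - 1 by ring,
      show z + a - 2 * ((n : ℂ) + 1) = z + a - 2 * n - 2 by ring,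
      show z + a - ((n : ℂ) + 1) + 1 = z + a - n by ring]
    field_simp

/-- The constant factor of the generator `S^c`. -/
noncomputable def genEFactor (τ η : ℂ) (c : Fin 4) : ℂ := (if c = 2 then Complex.I else 1) * theta τ c η

theorem genE_zero_apply (τ η l : ℂ) (c : Fin 4) (z : ℂ) : genE τ η l c 0 z =
    genEFactor τ η c * (theta τ c (2 * (η * (z - l))) / ell τ η z) := by
  simp only [genE, genEFactor, ell, if_true, ← mul_assoc]
  ring

theorem genE_one_apply (τ η l : ℂ) (c : Fin 4) (z : ℂ) : genE τ η l c 1 z =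
    -(genEFactor τ η c * (theta τ c (2 * (-(η * (z + l)))) / ell τ η z)) := by
  simp only [genE, genEFactor, ell, if_true, one_ne_zero, if_false]
  rw [show 2 * -(η * (z + l)) = -(2 * η * (z + l)) by ring]
  ring

/-- The coefficients of `W(a) S^c_l = S^c_{-1-l} W(a)`, without the constant factor of `S^c`. -/
theorem eventually_interE_rel (hτ : 0 < τ.im) (hη : 0 < η.im)
    (hell : ∀ k : ℕ, 1 ≤ k → ell τ η k ≠ 0) {a l l' : ℂ} (hl : a = 2 * l + 1) (hl' : l' = -1 - l)
    (c : Fin 4) (n : ℕ) : ∀ᶠ z in codiscrete ℂ,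
      interE τ η a (n + 1) z *
          (theta τ c (2 * (η * (z + a - 2 * (n + 1) - l))) / ell τ η (z + a - 2 * (n + 1))) -
        interE τ η a n z * (theta τ c (2 * (-(η * (z + a - 2 * n + l)))) / ell τ η (z + a - 2 * n)) =
      theta τ c (2 * (η * (z - l'))) / ell τ η z * interE τ η a (n + 1) (z + 1) -
        theta τ c (2 * (-(η * (z + l')))) / ell τ η z * interE τ η a n (z - 1) := by
  filter_upwards [eventually_interE_succ hτ hell a n,
    eventually_interE_add_one hτ hη hell a (n + 1),
    eventually_codiscrete_add (eventually_interE_add_one hτ hη hell a n) (-1),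
    eventually_theta_ne_zero hτ hη hell c (η * (a - 2 * n - 1)),
    eventually_ell_ne_zero hτ hell (a - 2 * n), eventually_ell_ne_zero hτ hell 0,
    eventually_ell_ne_zero hτ hell (a - 2 * n - 2), eventually_ell_ne_zero hτ hell (a - n),
    eventually_ell_ne_zero hτ hell (-n - 1), eventually_ell_ne_zero hτ hell (a - 2 * n - 1)]
    with z h1 h2 h3 h4 e1 e2 e3 e4 e5 e6
  have e8 := hell (n + 1) (by omega)
  push_cast at e8 h2
  rw [show z + (a - 2 * n) = z + a - 2 * n by ring] at e1
  rw [add_zero] at e2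
  rw [show z + (a - 2 * n - 2) = z + a - 2 * n - 2 by ring] at e3
  rw [show z + (a - n) = z + a - n by ring] at e4
  rw [show z + (-(n : ℂ) - 1) = z - n - 1 by ring] at e5
  rw [show z + (a - 2 * n - 1) = z + a - 2 * n - 1 by ring] at e6
  rw [show z + a - 2 * ((n : ℂ) + 1) + 1 = z + a - 2 * n - 1 by ring,
      show z - ((n : ℂ) + 1) = z - n - 1 by ring,
      show z + a - 2 * ((n : ℂ) + 1) = z + a - 2 * n - 2 by ring,
      show z + a - ((n : ℂ) + 1) + 1 = z + a - n by ring] at h2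
  rw [neg_add_cancel_right, ← sub_eq_add_neg,
    show z - 1 + a - 2 * n + 1 = z + a - 2 * n by ring,
    show z - 1 - n = z - n - 1 by ring,
    show z - 1 + a - 2 * n = z + a - 2 * n - 1 by ring,
    show z - 1 + a - n + 1 = z + a - n by ring] at h3
  have h3' : interE τ η a n (z - 1) = interE τ η a n z *
      (ell τ η (z + a - 2 * n - 1) * ell τ η (z + a - n) /
        (ell τ η (z + a - 2 * n) * ell τ η (z - n - 1))) := by
    rw [h3]
    field_simp
  -- The `sᵢ` are half the arguments of the four theta values in the goal. Their six differences
  -- give, up to sign, the elliptic numbers in the coefficient ratios `h1`, `h2`, `h3'`.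
  have key := sum_theta_eq_zero hτ (s₁ := η * (z + a - 2 * (n + 1) - l))
    (s₂ := -(η * (z + a - 2 * n + l))) (s₃ := η * (z - l')) (s₄ := -(η * (z + l'))) (c := c)
    (by rw [hl']; ring) (by convert h4 using 2; rw [hl']; ring)
  have d12 : theta τ 0 (η * (z + a - 2 * (n + 1) - l) - -(η * (z + a - 2 * n + l))) =
      ell τ η (z + a - 2 * n - 1) := by rw [ell]; ring_nf
  have d13 : theta τ 0 (η * (z + a - 2 * (n + 1) - l) - η * (z - l')) = -ell τ η (n + 1) := by
    rw [← ell_neg, ell, hl, hl']; ring_nf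
  have d14 : theta τ 0 (η * (z + a - 2 * (n + 1) - l) - -(η * (z + l'))) = ell τ η (z - n - 1) := by
    rw [ell, hl, hl']; ring_nf
  have d23 : theta τ 0 (-(η * (z + a - 2 * n + l)) - η * (z - l')) = -ell τ η (z + a - n) := by
    rw [← ell_neg, ell, hl, hl']; ring_nf
  have d24 : theta τ 0 (-(η * (z + a - 2 * n + l)) - -(η * (z + l'))) = ell τ η (n - a) := by
    rw [ell, hl, hl']; ring_nf
  have d34 : theta τ 0 (η * (z - l') - -(η * (z + l'))) = ell τ η z := by
    rw [ell]; ring_nf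
  rw [d12, d13, d14, d23, d24, d34] at key
  rw [h2, h1, h3']
  have e9 : z + a - 2 * ((n : ℂ) + 1) = z + a - 2 * n - 2 := by ring
  generalize theta τ c (2 * (η * (z + a - 2 * (n + 1) - l))) = t1 at key ⊢
  generalize theta τ c (2 * -(η * (z + a - 2 * n + l))) = t2 at key ⊢
  generalize theta τ c (2 * (η * (z - l'))) = t3 at key ⊢
  generalize theta τ c (2 * -(η * (z + l'))) = t4 at key ⊢
  rw [e9]
  field_simp
  linear_combination -interE τ η a n z * key

theorem interE_gen (hτ : 0 < τ.im) (hη : 0 < η.im)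
    (hell : ∀ k : ℕ, 1 ≤ k → ell τ η k ≠ 0) {a l l' : ℂ} (hl : a = 2 * l + 1) (hl' : l' = -1 - l)
    (c : Fin 4) : ShiftEq (shiftMul a (interE τ η a) (genE τ η l c))
      (shiftMul 1 (genE τ η l' c) (interE τ η a)) := by
  rintro (_ | n)
  -- At order zero the theta factors coincide because `z + a - l = z - l'`; what is left is the
  -- difference equation of the leading coefficient.
  · filter_upwards [eventually_interE_zero_add_one hτ hη hell a,
      eventually_ell_ne_zero hτ hell 0] with z h hz
    rw [add_zero] at hz
    rw [shiftMul_genE_zero, genE_shiftMul_zero, h, genE_zero_apply, genE_zero_apply,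
      show z + a - l = z - l' by rw [hl, hl']; ring]
    field_simp
  · filter_upwards [eventually_interE_rel hτ hη hell hl hl' c n] with z h
    rw [shiftMul_genE_succ, genE_shiftMul_succ, genE_zero_apply, genE_zero_apply, genE_one_apply,
      genE_one_apply]
    linear_combination genEFactor τ η c * h

theorem interE_laxRelShift (hτ : 0 < τ.im) (hη : 0 < η.im)
    (hell : ∀ k : ℕ, 1 ≤ k → ell τ η k ≠ 0) (u₁ u₂ : ℂ) :
    LaxRelShift (u₁ - u₂) (interE τ η (u₁ - u₂)) (laxE τ η u₁ u₂) (laxE τ η u₂ u₁) := by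
  rw [laxE, laxE, add_comm u₂ u₁]
  exact laxRelShift_of_gen fun c => interE_gen hτ hη hell (by ring) (by ring) c

/-- Vectors `θ_c(2s)`, `c = 0, …, 3`, at generic points are not proportional. -/
theorem eq_zero_of_mul_theta_eq (hτ : 0 < τ.im) {s t A B : ℂ} (h1 : theta τ 0 (s + t) ≠ 0)
    (h2 : theta τ 0 (s - t) ≠ 0) (h : ∀ c, A * theta τ c (2 * s) = B * theta τ c (2 * t)) :
    A = 0 := by
  have hw := theta_zero_mul hτ s t
  have split : ∀ s c, theta τ c (2 * s) * theta τ c 0 = theta τ c (s + s) * theta τ c (s - s) :=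
    fun s c => by rw [two_mul, sub_self]
  have hh : ∀ c, A * (theta τ c (s + s) * theta τ c (s - s)) =
      B * (theta τ c (t + t) * theta τ c (t - t)) := fun c => by
    rw [← split, ← split, ← mul_assoc, h, mul_assoc]
  have k1 := hh 1
  have k2 := hh 2
  have k3 := hh 3
  rw [theta_one_mul hτ, theta_one_mul hτ] at k1
  rw [theta_two_mul hτ, theta_two_mul hτ] at k2
  rw [theta_three_mul hτ, theta_three_mul hτ] at k3
  -- The identities for `c = 1, 2, 3` say that `A v(s)² = B v(t)²` in the symmetric square of the
  -- plane, `v = (theta2 τ 0, theta2 τ 1)`. Pairing with the covector that kills `v(t)` leaves `A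
  -- det(v(s), v(t)) v(s) = 0`.
  have z0 : A * (theta τ 0 (s + t) * theta τ 0 (s - t)) * theta2 τ 0 s = 0 := by
    rw [hw]
    linear_combination (theta2 τ 1 t / 2) * (k2 + k3) - (theta2 τ 0 t / 2) * k1
  have z1 : A * (theta τ 0 (s + t) * theta τ 0 (s - t)) * theta2 τ 1 s = 0 := by
    rw [hw]
    linear_combination (theta2 τ 1 t / 2) * k1 - (theta2 τ 0 t / 2) * (k2 - k3)
  have hne := mul_ne_zero h1 h2
  by_contra hA
  have y0 := (mul_eq_zero.mp z0).resolve_left (mul_ne_zero hA hne)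
  have y1 := (mul_eq_zero.mp z1).resolve_left (mul_ne_zero hA hne)
  apply hne
  rw [hw, y0, y1]
  ring

end Elliptic

/-! ### Uniqueness of the elliptic intertwiner -/

theorem interE_unique {τ η : ℂ} (hτ : 0 < τ.im) (hη : 0 < η.im)
    (hell : ∀ k : ℕ, 1 ≤ k → ell τ η k ≠ 0) {u₁ u₂ : ℂ}
    (hw : ∀ c, weightE τ η (η * (u₁ + u₂ + 1)) c ≠ 0) {T : ShiftCoeffs}
    (hmero : ∀ k, Meromorphic (T k))
    (hT : LaxRelShift (u₁ - u₂) T (laxE τ η u₁ u₂) (laxE τ η u₂ u₁)) :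
    ∃ p : ℂ → ℂ, Meromorphic p ∧ (fun z => p (z + 1)) =ᶠ[codiscrete ℂ] p ∧
      ShiftEq T (fun k z => p z * interE τ η (u₁ - u₂) k z) := by
  rw [laxE, laxE, add_comm u₂ u₁] at hT
  have hgen := gen_of_laxRelShift hw hT
  obtain ⟨a, ha⟩ : ∃ a, a = u₁ - u₂ := ⟨_, rfl⟩
  obtain ⟨l, hl⟩ : ∃ l, l = (u₁ - u₂ - 1) / 2 := ⟨_, rfl⟩
  obtain ⟨l', hl'⟩ : ∃ l', l' = (u₂ - u₁ - 1) / 2 := ⟨_, rfl⟩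
  rw [← hl, ← hl', ← ha] at hgen
  rw [← ha]
  have hal : a = 2 * l + 1 := by rw [ha, hl]; ring
  have hll' : l' = -1 - l := by rw [hl', hl]; ring
  -- A weight is a quotient with denominator `θ_{c+1}(η)`, and division by zero gives zero; so a
  -- nonzero weight also makes the constant factor of the generator nonzero.
  have hfac : ∀ c, genEFactor τ η c ≠ 0 := fun c =>
    mul_ne_zero (by split_ifs <;> simp) (div_ne_zero_iff.mp (hw c)).2
  have hW := eventually_interE_zero_ne_zero hτ hη hell a
  have hell0 := eventually_ell_ne_zero hτ hell 0
  simp only [add_zero] at hell0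
  have hp : ∀ᶠ z in codiscrete ℂ,
      T 0 (z + 1) / interE τ η a 0 (z + 1) = T 0 z / interE τ η a 0 z := by
    filter_upwards [hgen 0 0, eventually_interE_zero_add_one hτ hη hell a, hW,
      eventually_codiscrete_add hW 1, hell0, eventually_ell_ne_zero hτ hell a,
      eventually_theta_ne_zero hτ hη hell 0 (-(2 * η * l'))] with z h1 h2 h3 h4 h5 h6 h7
    rw [shiftMul_genE_zero, genE_shiftMul_zero, genE_zero_apply, genE_zero_apply,
      show z + a - l = z - l' by rw [hal, hll']; ring] at h1
    rw [show 2 * η * z + -(2 * η * l') = 2 * (η * (z - l')) by ring] at h7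
    have h8 := mul_ne_zero (hfac 0) h7
    generalize genEFactor τ η 0 = g at h1 h8
    generalize theta τ 0 (2 * (η * (z - l'))) = t at h1 h8
    rw [div_eq_div_iff h4 h3, h2]
    apply mul_left_cancel₀ h8
    field_simp at h1 ⊢
    linear_combination -h1
  refine ⟨fun z => T 0 z / interE τ η a 0 z,
    (hmero 0).fun_div (meromorphic_interE hτ hη a 0), hp, fun n => ?_⟩
  induction n with
  | zero =>
    filter_upwards [hW] with z hz
    field_simp
  | succ n ih =>
    obtain ⟨p, hpdef⟩ : ∃ p : ℂ → ℂ, p = fun z => T 0 z / interE τ η a 0 z := ⟨_, rfl⟩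
    have hp' : ∀ᶠ z in codiscrete ℂ, p (z + 1) = p z := by rw [hpdef]; exact hp
    have ih' : ∀ᶠ z in codiscrete ℂ, T n z = p z * interE τ η a n z := by rw [hpdef]; exact ih
    have hgen' : ∀ᶠ z in codiscrete ℂ, ∀ c, shiftMul a T (genE τ η l c) (n + 1) z =
        shiftMul 1 (genE τ η l' c) T (n + 1) z := eventually_all.mpr fun c => hgen c (n + 1)
    have hrel := eventually_all.mpr fun c => eventually_interE_rel hτ hη hell hal hll' c n
    have goal : ∀ᶠ z in codiscrete ℂ, T (n + 1) z = p z * interE τ η a (n + 1) z := by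
      filter_upwards [hgen', hrel, ih', eventually_codiscrete_add ih' (-1),
        eventually_codiscrete_add hp' (-1), eventually_ell_ne_zero hτ hell (a - 2 * (n + 1)),
        eventually_theta_ne_zero hτ hη hell 0 (η * (a - 2 * n - 1))] with z h1 h2 h3 h4 h5 e1 e2
      rw [neg_add_cancel_right] at h5
      rw [← h5, ← sub_eq_add_neg] at h4
      rw [← add_sub_assoc] at e1
      have e3 := hell (n + 1) (by omega)
      push_cast at e3
      -- Subtracting `p` times the relation for `W` removes the order `n` terms, since `p` is
      -- periodic. For each `c` there remains one multiple of `θ_c(2s)` equal to a multiple of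
      -- `θ_c(2t)`. Here `s - t = -2η(n + 1)`, so `[n + 1] ≠ 0` provides the genericity that does
      -- not depend on `z`.
      have hA := eq_zero_of_mul_theta_eq hτ (s := η * (z + a - 2 * (n + 1) - l)) (t := η * (z - l'))
        (A := (T (n + 1) z - p z * interE τ η a (n + 1) z) / ell τ η (z + a - 2 * (n + 1)))
        (B := (T (n + 1) (z + 1) - p z * interE τ η a (n + 1) (z + 1)) / ell τ η z) ?_ ?_ ?_
      · exact sub_eq_zero.mp ((div_eq_zero_iff.mp hA).resolve_right e1)
      · convert e2 using 2
        rw [hll']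
        ring
      · rw [show η * (z + a - 2 * (n + 1) - l) - η * (z - l') = 2 * η * (-(n + 1)) by
          rw [hal, hll']; ring]
        rw [← ell, ell_neg]
        exact neg_ne_zero.mpr e3
      · intro c
        have h1 := h1 c
        have h2 := h2 c
        rw [shiftMul_genE_succ, genE_shiftMul_succ, genE_zero_apply, genE_zero_apply,
          genE_one_apply, genE_one_apply, h3, h4] at h1
        apply mul_left_cancel₀ (hfac c)
        linear_combination h1 - genEFactor τ η c * p z * h2
    rw [hpdef] at goal
    exact goal

end YangBaxter

/-! ### The three cases together -/

theorem mainTheorem3 :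
    -- no deformation
    ((∀ lam : ℂ, (∀ n : ℤ, lam ≠ (n : ℂ)) →
        (∀ u₁ u₂ : ℂ, YangBaxter.LaxRelOn (YangBaxter.powerModule lam)
          (YangBaxter.interO (u₁ - u₂)) (YangBaxter.laxO u₁ u₂) (YangBaxter.laxO u₂ u₁)) ∧
        (∀ l : ℂ, ∀ c : Fin 4, ∀ f ∈ YangBaxter.powerModule lam,
          (YangBaxter.interO (2 * l + 1) * YangBaxter.genO l c) f =
            (YangBaxter.genO (-1 - l) c * YangBaxter.interO (2 * l + 1)) f) ∧
        (∀ u₁ u₂ : ℂ, (∀ n : ℤ, lam - (u₁ - u₂) ≠ (n : ℂ)) →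
          ∀ T : Module.End ℂ YangBaxter.PowerSums,
            YangBaxter.LaxRelOn (YangBaxter.powerModule lam) T
              (YangBaxter.laxO u₁ u₂) (YangBaxter.laxO u₂ u₁) →
            ∃ c : ℂ, ∀ f ∈ YangBaxter.powerModule lam,
              T f = c • YangBaxter.interO (u₁ - u₂) f))) ∧
    -- q-deformation, q = exp h
    (∀ h : ℂ, h.re < 0 → ∀ lam : ℂ, (∀ n : ℤ, YangBaxter.qpow h (2 * (lam + (n : ℂ))) ≠ 1) →
        (∀ u₁ u₂ : ℂ, YangBaxter.LaxRelOn (YangBaxter.powerModule lam)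
          (YangBaxter.interQ h (u₁ - u₂)) (YangBaxter.laxQ h u₁ u₂) (YangBaxter.laxQ h u₂ u₁)) ∧
        (∀ l : ℂ, ∀ c : Fin 4, ∀ f ∈ YangBaxter.powerModule lam,
          (YangBaxter.interQ h (2 * l + 1) * YangBaxter.genQ h l c) f =
            (YangBaxter.genQ h (-1 - l) c * YangBaxter.interQ h (2 * l + 1)) f) ∧
        (∀ u₁ u₂ : ℂ,
          (∀ n : ℤ, YangBaxter.qpow h (2 * (lam - (u₁ - u₂) + (n : ℂ))) ≠ 1) →
          (∀ c : Fin 4, YangBaxter.weightQ h ((u₁ + u₂ + 1) / 2) c ≠ 0) →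
          ∀ T : Module.End ℂ YangBaxter.PowerSums,
            (∀ f ∈ YangBaxter.powerModule lam,
              T f ∈ YangBaxter.powerModule (lam - (u₁ - u₂))) →
            YangBaxter.LaxRelOn (YangBaxter.powerModule lam) T
              (YangBaxter.laxQ h u₁ u₂) (YangBaxter.laxQ h u₂ u₁) →
            ∃ c : ℂ, ∀ f ∈ YangBaxter.powerModule lam,
              T f = c • YangBaxter.interQ h (u₁ - u₂) f)) ∧
    -- elliptic deformation
    (∀ τ η : ℂ, 0 < τ.im → 0 < η.im →
        (∀ k : ℕ, 1 ≤ k → YangBaxter.ell τ η (k : ℂ) ≠ 0) →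
        (∀ a : ℂ, ∀ k : ℕ, Meromorphic (YangBaxter.interE τ η a k)) ∧
        (∀ u₁ u₂ : ℂ, YangBaxter.LaxRelShift (u₁ - u₂)
          (YangBaxter.interE τ η (u₁ - u₂)) (YangBaxter.laxE τ η u₁ u₂)
          (YangBaxter.laxE τ η u₂ u₁)) ∧
        (∀ l : ℂ, ∀ c : Fin 4, YangBaxter.ShiftEq
          (YangBaxter.shiftMul (2 * l + 1) (YangBaxter.interE τ η (2 * l + 1))
            (YangBaxter.genE τ η l c))
          (YangBaxter.shiftMul 1 (YangBaxter.genE τ η (-1 - l) c)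
            (YangBaxter.interE τ η (2 * l + 1)))) ∧
        (∀ u₁ u₂ : ℂ,
          (∀ c : Fin 4, YangBaxter.weightE τ η (η * (u₁ + u₂ + 1)) c ≠ 0) →
          ∀ T : YangBaxter.ShiftCoeffs, (∀ k : ℕ, Meromorphic (T k)) →
            YangBaxter.LaxRelShift (u₁ - u₂) T
              (YangBaxter.laxE τ η u₁ u₂) (YangBaxter.laxE τ η u₂ u₁) →
            ∃ p : ℂ → ℂ, Meromorphic p ∧
              (fun z => p (z + 1)) =ᶠ[Filter.codiscrete ℂ] p ∧
              YangBaxter.ShiftEq T (fun k z => p z * YangBaxter.interE τ η (u₁ - u₂) k z))) := by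
  refine ⟨fun lam hlam => ⟨fun u₁ u₂ => YangBaxter.interO_laxRelOn hlam u₁ u₂,
    fun l c => YangBaxter.interO_gen hlam rfl c,
    fun u₁ u₂ ha T hT => YangBaxter.interO_unique hlam ha hT⟩,
    fun h hh lam hlam => ⟨fun u₁ u₂ => YangBaxter.interQ_laxRelOn hh hlam u₁ u₂,
    fun l c => YangBaxter.interQ_gen hh hlam rfl c,
    fun u₁ u₂ ha hw T hTV hT => YangBaxter.interQ_unique hh hlam ha hw hTV hT⟩,
    fun τ η hτ hη hell => ⟨fun a k => YangBaxter.meromorphic_interE hτ hη a k,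
    fun u₁ u₂ => YangBaxter.interE_laxRelShift hτ hη hell u₁ u₂,
    fun l c => YangBaxter.interE_gen hτ hη hell rfl rfl c,
    fun u₁ u₂ hw T hmero hT => YangBaxter.interE_unique hτ hη hell hw hmero hT⟩⟩
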